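/- Let $\Lambda$ be a one-dimensional lattice, either the infinite line $\mathbb Z$ or the ring $\mathbb Z/N$ with $N\ge 1$ sites (a line with periodic boundary conditions), with a $d$-dimensional quantum system at every site ($d\ge 1$). Let $\mathcal A$ be its algebra of observables: the norm closure of the $*$-algebra of operators $a\otimes 1$, with $a$ a matrix acting on finitely many sites (for a ring this is the algebra of all operators on $(\mathbb C^d)^{\otimes N}$; for $\mathbb Z$ it is the quasi-local C*-algebra). Say that an observable is localized on a set of sites $S$ if it has the form $a\otimes 1$ with $a$ acting on finitely many sites of $S$. Let $u:\mathcal A\to\mathcal A$ be the evolution (in the Heisenberg picture) of a quantum cellular automaton of range $L\ge 0$. That is, $u$ is a $*$-automorphism of $\mathcal A$ that commutes with translation by one site, and, for every site $n$, $u$ maps every observable localized on $n$ to an observable localized on the sites at distance at most $L$ from $n$. Let $r\ge 1$ be an integer with $r\ge L$, and regroup each $k=2r$ consecutive sites $kn,\dots,kn+k-1$ into one new site $n$, with algebra $\mathcal B_n\cong\mathcal B:=M_{d^{k}}(\mathbb C)$. On a ring, assume that $k$ divides $N$ and that there are at least three new sites, $N/k\ge 3$. For $b\in\mathcal B$, write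 $b_n\in\mathcal B_n$ for the copy of $b$ at the new site $n$. Then $$u=s_l\circ w\circ s_r\circ v ,$$ where all four factors are $*$-automorphisms of $\mathcal A$ and * $v$ and $w$ are products of identical on-site unitaries: there are unitaries $V,W\in\mathcal B$ with $v(b_n)=(V^\dagger bV)_n$ and $w(b_n)=(W^\dagger bW)_n$ for all $n$ and all $b\in\mathcal B$; * $s_l$ and $s_r$ are partial shifts by one new site, in opposite directions: there are tensor factorizations $\mathcal B=\mathcal P\otimes\mathcal Q=\mathcal P'\otimes\mathcal Q'$ into commuting $*$-subalgebras such that, for all $n$, $s_l(p_n)=p_{n+1}$ for $p\in\mathcal P$ and $s_l(q_n)=q_n$ for $q\in\mathcal Q$, while $s_r(p_n)=p_{n-1}$ for $p\in\mathcal P'$ and $s_r(q_n)=q_n$ for $q\in\mathcal Q'$. -/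

import Mathlib

namespace QCA

open scoped ENNReal

noncomputable section

/-! ### Spin configurations and operators on `ℓ²` of the configurations -/

/-- Classical configurations of a lattice `ι` with `d` levels at each site. They label the product
basis vectors of the tensor product of the site spaces `ℂ^d`. -/
abbrev Config (ι : Type) (d : ℕ) : Type := ι → Fin d

/-- The Hilbert space `ℓ²(X)`. -/
abbrev L2 (X : Type) : Type := lp (fun _ : X => ℂ) 2

theorem pull_sum_le {X : Type} (f : X ≃. X) (ψ : L2 X) (s : Finset X) :
    ∑ x ∈ s, ‖(f x).elim (0 : ℂ) (fun y => ψ y)‖ ^ (2 : ℝ≥0∞).toReal ≤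
      ‖ψ‖ ^ (2 : ℝ≥0∞).toReal := by
  classical
  refine le_trans ?_ (lp.sum_rpow_le_norm_rpow (by norm_num) ψ
    (s.filterMap f (fun _ _ _ h h' => f.inj h h')))
  rw [← Finset.sum_filter_add_sum_filter_not s (fun x => (f x).isSome)]
  have h0 : ∑ x ∈ s with ¬ (f x).isSome,
      ‖(f x).elim (0 : ℂ) (fun y => ψ y)‖ ^ (2 : ℝ≥0∞).toReal = 0 := by
    refine Finset.sum_eq_zero fun x hx => ?_
    have : f x = none := by simpa using (Finset.mem_filter.1 hx).2
    simp [this]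
  rw [h0, add_zero]
  refine le_of_eq (Finset.sum_bij (fun x hx => (f x).get (Finset.mem_filter.1 hx).2) ?_ ?_ ?_ ?_)
  · intro x hx
    simp only [Finset.mem_filterMap]
    exact ⟨x, (Finset.mem_filter.1 hx).1, by simp⟩
  · intro x hx x' hx' h
    exact f.inj (b := (f x).get (Finset.mem_filter.1 hx).2) (by simp) (by rw [h]; simp)
  · intro y hy
    obtain ⟨x, hx, hxy⟩ := (Finset.mem_filterMap _).1 hy
    refine ⟨x, Finset.mem_filter.2 ⟨hx, by simp [hxy]⟩, by simp [hxy]⟩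
  · intro x hx
    obtain ⟨y, hy⟩ := Option.isSome_iff_exists.1 (Finset.mem_filter.1 hx).2
    simp [hy]

/-- The partial isometry of `ℓ²(X)` given by a partial bijection `f`:
`(pull f ψ) x = ψ (f x)` where `f x` is defined, and `0` elsewhere. -/
def pull {X : Type} (f : X ≃. X) : L2 X →L[ℂ] L2 X :=
  LinearMap.mkContinuous
    { toFun := fun ψ => ⟨fun x => (f x).elim 0 (fun y => ψ y), memℓp_gen' (pull_sum_le f ψ)⟩
      map_add' := fun ψ φ => by
        ext x
        change (f x).elim (0 : ℂ) (fun y => (ψ + φ) y) =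
          (f x).elim (0 : ℂ) (fun y => ψ y) + (f x).elim (0 : ℂ) (fun y => φ y)
        rcases f x with _ | y <;> simp
      map_smul' := fun c ψ => by
        ext x
        change (f x).elim (0 : ℂ) (fun y => (c • ψ) y) = c * (f x).elim (0 : ℂ) (fun y => ψ y)
        rcases f x with _ | y <;> simp }
    1 (fun ψ => by
      rw [one_mul]
      exact lp.norm_le_of_forall_sum_le (by norm_num) (norm_nonneg _) (pull_sum_le f ψ))

theorem pull_apply {X : Type} (f : X ≃. X) (ψ : L2 X) (x : X) :
    pull f ψ x = (f x).elim 0 (fun y => ψ y) := rfl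

theorem pull_mul {X : Type} (f g : X ≃. X) : pull f * pull g = pull (f.trans g) := by
  ext ψ x
  change pull f (pull g ψ) x = _
  rw [pull_apply, pull_apply]
  rcases h : f x with _ | y
  · simp [PEquiv.trans, h]
  · simp [PEquiv.trans, h, pull_apply]

theorem pull_refl {X : Type} : pull (PEquiv.refl X) = 1 := by
  ext ψ x
  rfl

theorem star_pull {X : Type} (f : X ≃. X) : star (pull f) = pull f.symm := by
  rw [ContinuousLinearMap.star_eq_adjoint]
  symm
  rw [ContinuousLinearMap.eq_adjoint_iff]
  intro ψ φ
  rw [lp.inner_eq_tsum, lp.inner_eq_tsum]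
  have hsupp : ∀ (g : X ≃. X) (a b : L2 X),
      Function.support (fun x => inner ℂ (pull g a x) (b x)) ⊆ {x | (g x).isSome} := by
    intro g a b x hx
    by_contra hn
    have : g x = none := by simpa using hn
    exact hx (by simp [pull_apply, this])
  refine (tsum_eq_tsum_of_ne_zero_bij
    (fun x => (f x.1).get ?_) ?_ ?_ ?_)
  · by_contra hn
    have hn' : f x.1 = none := by simpa using hn
    exact x.2 (by simp [pull_apply, hn'])
  · intro x x' h
    have hx : (f x.1).isSome := by
      by_contra hn
      have hn' : f x.1 = none := by simpa using hn
      exact x.2 (by simp [pull_apply, hn'])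
    refine Subtype.ext (f.inj (b := (f x.1).get hx) (by simp) ?_)
    simp only [] at h
    rw [h]; simp
  · intro y hy
    obtain ⟨x, hx⟩ := Option.isSome_iff_exists.1 (hsupp f.symm ψ φ hy)
    have hfx : f x = some y := f.eq_some_iff.1 hx
    refine ⟨⟨x, ?_⟩, by simp [hfx]⟩
    have : inner ℂ (pull f.symm ψ y) (φ y) ≠ 0 := hy
    simpa [pull_apply, hx, hfx] using this
  · intro x
    obtain ⟨y, hy⟩ : ∃ y, f x.1 = some y := by
      rw [← Option.isSome_iff_exists]
      by_contra hn
      have hn' : f x.1 = none := by simpa using hn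
      exact x.2 (by simp [pull_apply, hn'])
    have hs : f.symm y = some x.1 := f.eq_some_iff.2 hy
    simp [pull_apply, hy, hs]

/-! ### Local operators -/

theorem extend_comp {ι : Type} {d k : ℕ} (e : Fin k ↪ ι) (y : Fin k → Fin d) (x : Config ι d) :
    Function.extend e y x ∘ e = y := by
  ext i
  simp [e.injective.extend_apply]

theorem extend_extend {ι : Type} {d k : ℕ} (e : Fin k ↪ ι) (y z : Fin k → Fin d)
    (x : Config ι d) : Function.extend e z (Function.extend e y x) = Function.extend e z x := by
  funext i
  by_cases h : ∃ j, e j = i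
  · obtain ⟨j, rfl⟩ := h
    simp [e.injective.extend_apply]
  · simp [Function.extend_apply' _ _ _ h]

theorem extend_self {ι : Type} {d k : ℕ} (e : Fin k ↪ ι) (x : Config ι d) :
    Function.extend e (x ∘ e) x = x := by
  funext i
  by_cases h : ∃ j, e j = i
  · obtain ⟨j, rfl⟩ := h
    simp [e.injective.extend_apply]
  · simp [Function.extend_apply' _ _ _ h]

/-- The partial bijection replacing the values `w` on the sites `e 0, …, e (k - 1)` by `y`. -/
def unitPE {ι : Type} {d k : ℕ} (e : Fin k ↪ ι) (w y : Fin k → Fin d) :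
    Config ι d ≃. Config ι d where
  toFun x := if x ∘ e = w then some (Function.extend e y x) else none
  invFun x := if x ∘ e = y then some (Function.extend e w x) else none
  inv x x' := by
    constructor
    · intro h
      split_ifs at h with h1
      cases h
      simp [extend_comp, extend_extend, ← h1, extend_self]
    · intro h
      split_ifs at h with h1
      cases h
      simp [extend_comp, extend_extend, ← h1, extend_self]

theorem unitPE_apply {ι : Type} {d k : ℕ} (e : Fin k ↪ ι) (w y : Fin k → Fin d)
    (x : Config ι d) :
    unitPE e w y x = if x ∘ e = w then some (Function.extend e y x) else none := rfl

/-- The operator `a ⊗ 1`, with the matrix `a` acting on the `k` distinct sites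
`e 0, …, e (k - 1)` and the identity on all other sites, as an operator on `ℓ²` of the
configurations. -/
def localOpFun {ι : Type} {d k : ℕ} (e : Fin k ↪ ι)
    (a : Matrix (Fin k → Fin d) (Fin k → Fin d) ℂ) :
    L2 (Config ι d) →L[ℂ] L2 (Config ι d) :=
  ∑ w, ∑ y, a w y • pull (unitPE e w y)

theorem localOpFun_apply {ι : Type} {d k : ℕ} (e : Fin k ↪ ι)
    (a : Matrix (Fin k → Fin d) (Fin k → Fin d) ℂ) (ψ : L2 (Config ι d)) (x : Config ι d) :
    localOpFun e a ψ x = ∑ y, a (x ∘ e) y * ψ (Function.extend e y x) := by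
  classical
  have h : localOpFun e a ψ = ∑ w, ∑ y, a w y • pull (unitPE e w y) ψ := by
    simp [localOpFun]
  rw [h, lp.coeFn_sum, Finset.sum_apply, Finset.sum_eq_single (x ∘ e)]
  · rw [lp.coeFn_sum, Finset.sum_apply]
    refine Finset.sum_congr rfl fun y _ => ?_
    simp [pull_apply, unitPE_apply]
  · intro w _ hw
    rw [lp.coeFn_sum, Finset.sum_apply]
    refine Finset.sum_eq_zero fun y _ => ?_
    simp [pull_apply, unitPE_apply, hw.symm]
  · simp

/-- `a ↦ a ⊗ 1` as a unital `*`-homomorphism from the matrix algebra of the sites `e`. -/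
def localOp {ι : Type} {d k : ℕ} (e : Fin k ↪ ι) :
    Matrix (Fin k → Fin d) (Fin k → Fin d) ℂ →⋆ₐ[ℂ]
      (L2 (Config ι d) →L[ℂ] L2 (Config ι d)) where
  toFun := localOpFun e
  map_one' := by
    ext ψ x
    simp [localOpFun_apply, Matrix.one_apply, extend_self]
  map_mul' a b := by
    ext ψ x
    change _ = localOpFun e a (localOpFun e b ψ) x
    simp only [localOpFun_apply, Matrix.mul_apply, extend_comp, extend_extend, Finset.sum_mul,
      Finset.mul_sum]
    rw [Finset.sum_comm]
    simp [mul_assoc]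
  map_zero' := by simp [localOpFun]
  map_add' a b := by
    simp [localOpFun, add_smul, Finset.sum_add_distrib]
  commutes' c := by
    ext ψ x
    simp [localOpFun_apply, Matrix.one_apply, extend_self, Algebra.algebraMap_eq_smul_one]
  map_star' a := by
    simp only [localOpFun, star_sum, star_smul, star_pull, Matrix.star_apply]
    rw [Finset.sum_comm]
    rfl

/-! ### The algebra of observables -/

/-- The algebra of observables of the lattice `ι` with a `d`-dimensional quantum system at every
site: the norm closure of the `*`-algebra of local operators (operators `a ⊗ 1` with `a` acting on
finitely many sites). For finite `ι` this is the algebra of all operators on `⨂_ι ℂ^d`; for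
infinite `ι` it is the quasi-local C*-algebra `⨂_ι M_d(ℂ)`. -/
def obsAlg (ι : Type) (d : ℕ) :
    StarSubalgebra ℂ (L2 (Config ι d) →L[ℂ] L2 (Config ι d)) :=
  (StarAlgebra.adjoin ℂ {A | ∃ (k : ℕ) (e : Fin k ↪ ι)
    (a : Matrix (Fin k → Fin d) (Fin k → Fin d) ℂ), A = localOp e a}).topologicalClosure

/-- The observable `a ⊗ 1`, with `a` acting on the sites `e 0, …, e (k - 1)`. -/
def localObs {ι : Type} {d k : ℕ} (e : Fin k ↪ ι) :
    Matrix (Fin k → Fin d) (Fin k → Fin d) ℂ →⋆ₐ[ℂ] obsAlg ι d :=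
  StarAlgHom.codRestrict (localOp e) (obsAlg ι d) fun a =>
    StarSubalgebra.le_topologicalClosure _ (StarAlgebra.subset_adjoin ℂ _ ⟨k, e, a, rfl⟩)

/-- `A` is localized on the region `Λ`: it is a matrix acting on finitely many sites of `Λ`,
tensored with the identity on all the other sites. -/
def IsLocalizedOn {ι : Type} {d : ℕ} (Λ : Set ι) (A : obsAlg ι d) : Prop :=
  ∃ (k : ℕ) (e : Fin k ↪ ι) (a : Matrix (Fin k → Fin d) (Fin k → Fin d) ℂ),
    Set.range e ⊆ Λ ∧ A = localObs e a

/-! ### Translations -/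

/-- Relabelling of the configurations by a permutation of the sites. -/
def configPerm {ι : Type} {d : ℕ} (g : Equiv.Perm ι) : Config ι d ≃. Config ι d :=
  (Equiv.arrowCongr g.symm (Equiv.refl (Fin d))).toPEquiv

theorem configPerm_apply {ι : Type} {d : ℕ} (g : Equiv.Perm ι) (x : Config ι d) :
    configPerm g x = some (x ∘ g) := rfl

/-- The unitary permuting the sites by `g`. -/
def sitePerm {ι : Type} (d : ℕ) (g : Equiv.Perm ι) : L2 (Config ι d) →L[ℂ] L2 (Config ι d) :=
  pull (configPerm g)

theorem sitePerm_apply {ι : Type} {d : ℕ} (g : Equiv.Perm ι) (ψ : L2 (Config ι d))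
    (x : Config ι d) : sitePerm d g ψ x = ψ (x ∘ g) := rfl

theorem sitePerm_mul_inv {ι : Type} {d : ℕ} (g : Equiv.Perm ι) :
    sitePerm d g * sitePerm d g⁻¹ = 1 := by
  ext ψ x
  change sitePerm d g (sitePerm d g⁻¹ ψ) x = ψ x
  rw [sitePerm_apply, sitePerm_apply]
  refine congrArg (fun y => ψ y) (funext fun i => ?_)
  simp

theorem star_sitePerm {ι : Type} {d : ℕ} (g : Equiv.Perm ι) :
    star (sitePerm d g) = sitePerm d g⁻¹ := by
  rw [sitePerm, star_pull]
  rfl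

theorem sitePerm_conj_localOp {ι : Type} {d k : ℕ} (g : Equiv.Perm ι) (e : Fin k ↪ ι)
    (a : Matrix (Fin k → Fin d) (Fin k → Fin d) ℂ) :
    sitePerm d g * localOp e a * sitePerm d g⁻¹ = localOp (e.trans g.toEmbedding) a := by
  ext ψ x
  change sitePerm d g (localOpFun e a (sitePerm d g⁻¹ ψ)) x = localOpFun _ a ψ x
  rw [sitePerm_apply, localOpFun_apply, localOpFun_apply]
  refine Finset.sum_congr rfl fun y _ => ?_
  rw [sitePerm_apply]
  refine congrArg₂ (· * ·) rfl (congrArg (fun y => ψ y) (funext fun i => ?_))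
  by_cases h : ∃ j, e j = g⁻¹ i
  · obtain ⟨j, hj⟩ := h
    have hi : i = (e.trans g.toEmbedding) j := by simp [hj]
    rw [hi, (e.trans g.toEmbedding).injective.extend_apply]
    simp [e.injective.extend_apply]
  · have h' : ¬ ∃ j, (e.trans g.toEmbedding) j = i := by
      rintro ⟨j, rfl⟩
      exact h ⟨j, by simp⟩
    rw [Function.extend_apply' _ _ _ h', Function.comp_apply, Function.extend_apply' _ _ _ h]
    simp

/-- Conjugation by the unitary permuting the sites by `g`, on all operators. -/
def permConj {ι : Type} (d : ℕ) (g : Equiv.Perm ι) :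
    (L2 (Config ι d) →L[ℂ] L2 (Config ι d)) →⋆ₐ[ℂ] (L2 (Config ι d) →L[ℂ] L2 (Config ι d)) where
  toFun A := sitePerm d g * A * sitePerm d g⁻¹
  map_one' := by rw [mul_one, sitePerm_mul_inv]
  map_mul' A B := by
    have h := sitePerm_mul_inv (d := d) g⁻¹
    rw [inv_inv] at h
    calc sitePerm d g * (A * B) * sitePerm d g⁻¹
        = sitePerm d g * A * 1 * B * sitePerm d g⁻¹ := by simp only [mul_one, mul_assoc]
      _ = _ := by rw [← h]; simp only [mul_assoc]
  map_zero' := by simp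
  map_add' A B := by rw [mul_add, add_mul]
  commutes' c := by
    rw [Algebra.algebraMap_eq_smul_one, mul_smul_comm, mul_one, smul_mul_assoc, sitePerm_mul_inv]
  map_star' A := by
    rw [star_mul, star_mul, star_sitePerm, star_sitePerm, inv_inv, mul_assoc]

theorem permConj_mem {ι : Type} {d : ℕ} (g : Equiv.Perm ι)
    {A : L2 (Config ι d) →L[ℂ] L2 (Config ι d)} (hA : A ∈ obsAlg ι d) :
    permConj d g A ∈ obsAlg ι d := by
  have hc : Continuous (permConj d g) := by
    change Continuous fun A => sitePerm d g * A * sitePerm d g⁻¹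
    fun_prop
  refine map_mem_closure hc hA ?_
  intro B hB
  have hle : StarAlgebra.adjoin ℂ {A | ∃ (k : ℕ) (e : Fin k ↪ ι)
      (a : Matrix (Fin k → Fin d) (Fin k → Fin d) ℂ), A = localOp e a} ≤
      (StarAlgebra.adjoin ℂ {A | ∃ (k : ℕ) (e : Fin k ↪ ι)
      (a : Matrix (Fin k → Fin d) (Fin k → Fin d) ℂ), A = localOp e a}).comap (permConj d g) := by
    rw [StarAlgebra.adjoin_le_iff]
    rintro _ ⟨k, e, a, rfl⟩
    exact StarAlgebra.subset_adjoin ℂ _ ⟨k, e.trans g.toEmbedding, a, sitePerm_conj_localOp g e a⟩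
  exact hle hB

theorem permConj_permConj {ι : Type} {d : ℕ} (g h : Equiv.Perm ι) (hgh : g * h = 1)
    (A : L2 (Config ι d) →L[ℂ] L2 (Config ι d)) : permConj d g (permConj d h A) = A := by
  obtain rfl : h = g⁻¹ := (inv_eq_of_mul_eq_one_right hgh).symm
  change sitePerm d g * (sitePerm d g⁻¹ * A * sitePerm d g⁻¹⁻¹) * sitePerm d g⁻¹ = A
  rw [inv_inv]
  calc _ = (sitePerm d g * sitePerm d g⁻¹) * A * (sitePerm d g * sitePerm d g⁻¹) := by
        simp only [mul_assoc]
    _ = A := by rw [sitePerm_mul_inv, one_mul, mul_one]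

/-- The automorphism of the algebra of observables induced by a permutation of the sites; it takes
the observable `a` at the sites `e 0, …, e (k - 1)` to `a` at `g (e 0), …, g (e (k - 1))`. -/
def permAut {ι : Type} (d : ℕ) (g : Equiv.Perm ι) : obsAlg ι d ≃⋆ₐ[ℂ] obsAlg ι d :=
  StarAlgEquiv.ofStarAlgHom
    (StarAlgHom.codRestrict ((permConj d g).comp (obsAlg ι d).subtype) (obsAlg ι d)
      fun A => permConj_mem g A.2)
    (StarAlgHom.codRestrict ((permConj d g⁻¹).comp (obsAlg ι d).subtype) (obsAlg ι d)
      fun A => permConj_mem g⁻¹ A.2)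
    (by ext1 A; exact Subtype.ext (permConj_permConj _ _ (inv_mul_cancel g) A.1))
    (by ext1 A; exact Subtype.ext (permConj_permConj _ _ (mul_inv_cancel g) A.1))

theorem permAut_localObs {ι : Type} {d k : ℕ} (g : Equiv.Perm ι) (e : Fin k ↪ ι)
    (a : Matrix (Fin k → Fin d) (Fin k → Fin d) ℂ) :
    permAut d g (localObs e a) = localObs (e.trans g.toEmbedding) a :=
  Subtype.ext (sitePerm_conj_localOp g e a)

/-! ### Quantum cellular automata on a line

The sites are indexed by `ZMod N`: this is the ring of `N` sites (the line with periodic boundary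
conditions) if `N > 0`, and the infinite line `ℤ` if `N = 0`. -/

/-- Translation by one site. -/
def translate (N d : ℕ) : obsAlg (ZMod N) d ≃⋆ₐ[ℂ] obsAlg (ZMod N) d :=
  permAut d (Equiv.addRight (1 : ZMod N))

/-- The sites at distance at most `L` from `n`. -/
def nbhd {N : ℕ} (L : ℕ) (n : ZMod N) : Set (ZMod N) :=
  {m | ∃ j : ℤ, |j| ≤ L ∧ m = n + (j : ZMod N)}

/-- A one-dimensional quantum cellular automaton of range `L`, in the Heisenberg picture: an
automorphism `u` of the algebra of observables that is causal and translation invariant. -/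
structure IsQCA {N d : ℕ} (L : ℕ) (u : obsAlg (ZMod N) d ≃⋆ₐ[ℂ] obsAlg (ZMod N) d) : Prop where
  causal : ∀ (n : ZMod N) (A : obsAlg (ZMod N) d),
    IsLocalizedOn {n} A → IsLocalizedOn (nbhd L n) (u A)
  translation_invariant : ∀ A, u (translate N d A) = translate N d (u A)

/-! ### Regrouping, on-site unitaries and partial shifts -/

/-- The `n`-th site of the line obtained by grouping `k` consecutive sites into one: it consists of
the sites `k n, k n + 1, …, k n + k - 1`. On a ring, `n` and `n + N / k` give the same block. -/
def block {N k : ℕ} (hk : k ∣ N) (n : ℤ) : Fin k ↪ ZMod N where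
  toFun j := ((k * n + (j : ℕ) : ℤ) : ZMod N)
  inj' i j h := by
    have h1 : (N : ℤ) ∣ (k * n + (j : ℕ)) - (k * n + (i : ℕ)) :=
      (ZMod.intCast_eq_intCast_iff_dvd_sub _ _ N).1 h
    have h2 : (k : ℤ) ∣ ((j : ℕ) : ℤ) - ((i : ℕ) : ℤ) := by
      have := (Int.natCast_dvd_natCast.2 hk).trans h1
      rwa [add_sub_add_left_eq_sub] at this
    have h3 : ((i : ℕ) : ℤ) ≡ ((j : ℕ) : ℤ) [ZMOD k] := (Int.modEq_iff_dvd).2 h2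
    have h4 : (i : ℕ) ≡ (j : ℕ) [MOD k] := Int.natCast_modEq_iff.1 h3
    exact Fin.ext (Nat.ModEq.eq_of_lt_of_lt h4 i.2 j.2)

/-- The observable `a` at the `n`-th regrouped site. The algebra of a regrouped site is the algebra
of matrices on the tensor product of its `k` original sites. -/
abbrev blockObs {N d k : ℕ} (hk : k ∣ N) (n : ℤ) :
    Matrix (Fin k → Fin d) (Fin k → Fin d) ℂ →⋆ₐ[ℂ] obsAlg (ZMod N) d :=
  localObs (block hk n)

/-- `v` is a product of identical on-site unitaries on the regrouped line: it acts as
`a ↦ V† a V` at every regrouped site. -/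
def IsOnSiteUnitary {N d k : ℕ} (hk : k ∣ N)
    (v : obsAlg (ZMod N) d ≃⋆ₐ[ℂ] obsAlg (ZMod N) d) : Prop :=
  ∃ V ∈ Matrix.unitaryGroup (Fin k → Fin d) ℂ, ∀ (n : ℤ) a,
    v (blockObs hk n a) = blockObs hk n (star V * a * V)

/-- `s` is a partial shift by `δ` on the regrouped line: the algebra of a regrouped site is a tensor
product `P ⊗ Q` of two `*`-subalgebras (subsystems), and `s` moves `P` from every regrouped site `n`
to the regrouped site `n + δ` while it leaves `Q` at every regrouped site in place. -/
def IsPartialShift {N d k : ℕ} (hk : k ∣ N) (δ : ℤ)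
    (s : obsAlg (ZMod N) d ≃⋆ₐ[ℂ] obsAlg (ZMod N) d) : Prop :=
  ∃ P Q : StarSubalgebra ℂ (Matrix (Fin k → Fin d) (Fin k → Fin d) ℂ),
    (∀ a ∈ P, ∀ b ∈ Q, Commute a b) ∧
    Function.Bijective
      (Submodule.mulMap (Subalgebra.toSubmodule P.toSubalgebra)
        (Subalgebra.toSubmodule Q.toSubalgebra)) ∧
    (∀ (n : ℤ), ∀ a ∈ P, s (blockObs hk n a) = blockObs hk (n + δ) a) ∧
    (∀ (n : ℤ), ∀ b ∈ Q, s (blockObs hk n b) = blockObs hk n b)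

end

end QCA

/-! Write B_n for the algebra of block n. Since L ≤ r, the image u(B_n) lives on the right half of
block n-1, on block n, and on the left half of block n+1. Let s_l be the shift moving all left
halves one block to the right (`halfShift`). Undoing it puts these four half-blocks exactly into the
blocks n-1 and n. So t = s_l⁻¹ ∘ u is an automorphism sending B_n into the algebra generated by
B_(n-1) and B_n (`IsQCA.halfShift_symm_comp_mem`), and it commutes with block translations.

The rest is a support algebra argument. Expand t(c), for c in B_0, in the matrix units of one of its
two target blocks. The coefficients (`slice`) lie in the other block. They also commute with t(B_n)
for n ≠ 0, because with at least three blocks t(B_n) misses block -1 or block 0. Applying t⁻¹ gives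
operators commuting with all B_n, n ≠ 0, and such operators lie in B_0
(`IsQuasiLocal.mem_range_of_commute`). Hence all coefficients are themselves of the form t(q) with q
in B_0 (`IsQuasiLocal.exists_slice_eq`), and this forces B_0 = P ⊗ Q with t(P) in B_(-1) and t(Q) in
B_0 (`IsQuasiLocal.mulMap_transportedAlg_bijective`).

Read inside a single matrix algebra, the restrictions of t to P and Q have commuting ranges, because
P of block 1 and Q of block 0 arrive together in block 0. They therefore combine to a *-endomorphism
of the matrix algebra, which is inner, say given by W. With w the product of these unitaries, s_r =
w⁻¹ ∘ t moves P one block to the left and fixes Q (`IsQuasiLocal.exists_onSite_comp_shift`). The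
factor v can be the identity. -/

namespace QCA

open scoped ENNReal Topology TensorProduct
open Filter

/-! ### Matrix coefficients relative to a matrix subalgebra -/

section Slice

variable {A m : Type} [Ring A] [StarRing A] [Algebra ℂ A] [Fintype m] [DecidableEq m]
  (β : Matrix m m ℂ →⋆ₐ[ℂ] A)

/-- The `(a, b)` matrix coefficient of an operator with respect to a matrix subalgebra; the
coefficients lie in the commutant of the matrix subalgebra. -/
noncomputable def slice (a b : m) : A →ₗ[ℂ] A :=
  ∑ k, LinearMap.mulLeft ℂ (β (Matrix.single k a 1)) ∘ₗ
    LinearMap.mulRight ℂ (β (Matrix.single b k 1))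

theorem slice_apply (a b : m) (x : A) :
    slice β a b x = ∑ k, β (Matrix.single k a 1) * x * β (Matrix.single b k 1) := by
  simp [slice, mul_assoc]

theorem sum_map_single_self : ∑ k, β (Matrix.single k k 1) = 1 := by
  rw [← map_sum, Matrix.sum_single_one, map_one]

theorem map_single_mul (a b c e : m) :
    β (Matrix.single a b 1) * β (Matrix.single c e 1) =
      if b = c then β (Matrix.single a e 1) else 0 := by
  rw [← map_mul]
  split_ifs with h
  · subst h; simp
  · simp [h]

theorem map_eq_sum (a : Matrix m m ℂ) :
    β a = ∑ i, ∑ j, a i j • β (Matrix.single i j 1) := by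
  conv_lhs => rw [Matrix.matrix_eq_sum_single a]
  simp only [map_sum, ← map_smul]
  refine Finset.sum_congr rfl fun i _ => Finset.sum_congr rfl fun j _ => ?_
  simp [Matrix.smul_single]

theorem commute_of_commute_single {x : A}
    (h : ∀ i j, Commute (β (Matrix.single i j 1)) x) (a : Matrix m m ℂ) : Commute (β a) x := by
  rw [map_eq_sum]
  exact Commute.sum_left _ _ _ fun i _ => Commute.sum_left _ _ _ fun j _ => (h i j).smul_left _

theorem single_mul_slice (i j a b : m) (x : A) :
    β (Matrix.single i j 1) * slice β a b x =
      β (Matrix.single i a 1) * x * β (Matrix.single b j 1) := by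
  simp [slice_apply, Finset.mul_sum, ← mul_assoc, map_single_mul, ite_mul]

theorem slice_mul_single (i j a b : m) (x : A) :
    slice β a b x * β (Matrix.single i j 1) =
      β (Matrix.single i a 1) * x * β (Matrix.single b j 1) := by
  simp [slice_apply, Finset.sum_mul, mul_assoc, map_single_mul]

/-- Multiplying a slice by a matrix unit from either side collapses the sum to the same single term.
-/
theorem commute_slice (c : Matrix m m ℂ) (a b : m) (x : A) : Commute (β c) (slice β a b x) :=
  commute_of_commute_single β (fun i j => by
    rw [commute_iff_eq, single_mul_slice, slice_mul_single]) c

/-- The term for `a`, `b` is the corner of `x` cut out by the diagonal projections `a` and `b`. This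
expansion exhibits the algebra as the matrix algebra tensor its commutant. -/
theorem sum_slice_mul_single (x : A) :
    ∑ a, ∑ b, slice β a b x * β (Matrix.single a b 1) = x := by
  simp only [slice_mul_single]
  calc _ = (∑ a, β (Matrix.single a a 1)) * x * ∑ b, β (Matrix.single b b 1) := by
        simp only [Finset.sum_mul, Finset.mul_sum]
        rw [Finset.sum_comm]
    _ = x := by simp [sum_map_single_self]

theorem slice_of_commute {x : A} (h : ∀ c, Commute (β c) x) (a b : m) :
    slice β a b x = if a = b then x else 0 := by
  rw [slice_apply]
  calc _ = ∑ k, x * (β (Matrix.single k a 1) * β (Matrix.single b k 1)) :=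
        Finset.sum_congr rfl fun k _ => by rw [(h _).eq, mul_assoc]
    _ = _ := by
        simp only [map_single_mul]
        split_ifs
        · rw [← Finset.mul_sum, sum_map_single_self, mul_one]
        · simp

theorem slice_map_mul {x : A} (h : ∀ c, Commute (β c) x) (y : Matrix m m ℂ) (a b : m) :
    slice β a b (β y * x) = y a b • x := by
  rw [slice_apply]
  have : ∀ k, β (Matrix.single k a 1) * (β y * x) * β (Matrix.single b k 1) =
      y a b • (β (Matrix.single k k 1) * x) := fun k => by
    rw [mul_assoc, mul_assoc, ← (h _).eq, ← mul_assoc (β y), ← mul_assoc, ← map_mul, ← map_mul,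
      ← smul_mul_assoc, ← map_smul]
    congr 2
    rw [← Matrix.mul_assoc, Matrix.single_mul_mul_single]
    simp [Matrix.smul_single]
  rw [Finset.sum_congr rfl fun k _ => this k, ← Finset.smul_sum, ← Finset.sum_mul,
    sum_map_single_self, one_mul]

/-- Inserting the resolution of the identity by diagonal matrix units between `x` and `y` makes
coefficients multiply like matrix entries. -/
theorem slice_mul (a b : m) (x y : A) :
    slice β a b (x * y) = ∑ c, slice β a c x * slice β c b y := by
  have h : ∀ c, slice β a c x * slice β c b y =
      ∑ k, β (Matrix.single k a 1) * x * β (Matrix.single c c 1) * y * β (Matrix.single b k 1) :=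
    fun c => by
      rw [slice_apply β c b, Finset.mul_sum]
      refine Finset.sum_congr rfl fun k _ => ?_
      rw [← mul_assoc, ← mul_assoc, slice_mul_single]
  simp only [h]
  rw [Finset.sum_comm, slice_apply]
  refine Finset.sum_congr rfl fun k _ => ?_
  rw [← Finset.sum_mul, ← Finset.sum_mul, ← Finset.mul_sum, sum_map_single_self, mul_one,
    mul_assoc _ x y]

theorem commute_slice_of_commute {x z : A} (h : ∀ c, Commute (β c) x) (hz : Commute x z)
    (a b : m) : Commute x (slice β a b z) := by
  rw [slice_apply]
  exact Commute.sum_right _ _ _ fun k _ => ((h _).symm.mul_right hz).mul_right (h _).symm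

theorem map_injective [Nontrivial A] : Function.Injective β := by
  rw [injective_iff_map_eq_zero]
  intro y hy
  ext a b
  have := slice_map_mul β (x := 1) (fun c => Commute.one_right _) y a b
  rw [hy, zero_mul, map_zero] at this
  simpa using this.symm

end Slice

/-! ### An isometry on the commutant -/

section Norm

variable {A m : Type} [CStarAlgebra A] [Fintype m] [DecidableEq m]
  (β : Matrix m m ℂ →⋆ₐ[ℂ] A)

/-- Multiplication by a minimal projection of a matrix subalgebra is isometric on its commutant. -/
theorem norm_mul_single {c : A} (hc : ∀ a, Commute (β a) c) (i : m) :
    ‖c * β (Matrix.single i i 1)‖ = ‖c‖ := by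
  let C : StarSubalgebra ℂ A := StarSubalgebra.centralizer ℂ (Set.range β)
  have : IsClosed (C : Set A) := by
    rw [StarSubalgebra.coe_centralizer]
    exact Set.isClosed_centralizer _
  have hC : ∀ x : C, ∀ a, Commute (β a) (x : A) := fun x a =>
    ((StarSubalgebra.mem_centralizer_iff ℂ).1 x.2 _ ⟨a, rfl⟩).1
  have hcC : c ∈ C := (StarSubalgebra.mem_centralizer_iff ℂ).2 (by
    rintro _ ⟨a, rfl⟩
    exact ⟨hc a, by rw [← map_star]; exact hc _⟩)
  -- Multiplicative because the matrix unit is a projection commuting with `C`; non-unital because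
  -- it is not the identity in general.
  let φ : C →⋆ₙₐ[ℂ] A :=
    { toFun := fun x => (x : A) * β (Matrix.single i i 1)
      map_zero' := by simp
      map_add' := fun x y => by simp [add_mul]
      map_smul' := fun z x => by simp
      map_mul' := fun x y => by
        have h := (hC y (Matrix.single i i 1)).eq
        simp only [MulMemClass.coe_mul]
        rw [mul_assoc (x : A) _ (_ * _), ← mul_assoc (β _) (y : A), h, mul_assoc (y : A),
          map_single_mul, if_pos rfl, mul_assoc]
      map_star' := fun x => by
        rw [star_mul, ← map_star, StarMemClass.coe_star, ← StarMemClass.coe_star,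
          (hC (star x) _).eq, Matrix.star_eq_conjTranspose, Matrix.conjTranspose_single, star_one] }
  have hφ : Function.Injective φ := by
    rw [injective_iff_map_eq_zero]
    intro x hx
    have hx' : (x : A) * β (Matrix.single i i 1) = 0 := hx
    -- The corner at `i` is carried by matrix units to every other diagonal corner, so it determines
    -- `x`.
    have : (x : A) = ∑ k, β (Matrix.single k i 1) * ((x : A) * β (Matrix.single i i 1)) *
        β (Matrix.single i k 1) := by
      calc (x : A) = (x : A) * ∑ k, β (Matrix.single k k 1) := by rw [sum_map_single_self, mul_one]
        _ = _ := by
          rw [Finset.mul_sum]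
          refine Finset.sum_congr rfl fun k _ => ?_
          rw [← mul_assoc, (hC x _).eq, mul_assoc, mul_assoc, map_single_mul, if_pos rfl,
            map_single_mul, if_pos rfl]
    apply Subtype.ext
    rw [this, hx']
    simp
  -- Injective *-homomorphisms between C*-algebras are isometric.
  exact NonUnitalStarAlgHom.norm_map φ hφ ⟨c, hcC⟩

end Norm

/-! ### Algebras generated by regions -/

section Region

variable {A m J : Type} [Ring A] [StarRing A] [Algebra ℂ A] [Fintype m] [DecidableEq m]
  (β : J → Matrix m m ℂ →⋆ₐ[ℂ] A)

/-- The algebra generated by the matrix algebras attached to the sites of a region. -/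
def regionAlg (G : Set J) : Subalgebra ℂ A :=
  Algebra.adjoin ℂ {x | ∃ j ∈ G, ∃ a, β j a = x}

variable {β}

theorem map_mem_regionAlg {G : Set J} {j : J} (hj : j ∈ G) (a : Matrix m m ℂ) :
    β j a ∈ regionAlg β G :=
  Algebra.subset_adjoin ⟨j, hj, a, rfl⟩

theorem regionAlg_mono {G H : Set J} (h : G ⊆ H) : regionAlg β G ≤ regionAlg β H :=
  Algebra.adjoin_mono fun _ ⟨j, hj, a, ha⟩ => ⟨j, h hj, a, ha⟩

theorem regionAlg_le {G : Set J} {S : Subalgebra ℂ A} (h : ∀ j ∈ G, ∀ a, β j a ∈ S) :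
    regionAlg β G ≤ S :=
  Algebra.adjoin_le (by rintro _ ⟨j, hj, a, rfl⟩; exact h j hj a)

theorem regionAlg_singleton_le (j : J) : regionAlg β {j} ≤ (β j).toAlgHom.range :=
  regionAlg_le (by rintro _ rfl a; exact ⟨a, rfl⟩)

theorem commute_regionAlg {G : Set J} {x z : A} (hz : ∀ j ∈ G, ∀ a, Commute (β j a) z)
    (hx : x ∈ regionAlg β G) : Commute x z := by
  have : regionAlg β G ≤ Subalgebra.centralizer ℂ {z} :=
    regionAlg_le fun j hj a => (Subalgebra.mem_centralizer_iff ℂ).2 (by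
      rintro _ rfl; exact (hz j hj a).symm.eq)
  exact (((Subalgebra.mem_centralizer_iff ℂ).1 (this hx)) z rfl).symm

theorem exists_finset_mem_regionAlg {x : A} (hx : x ∈ regionAlg β Set.univ) :
    ∃ F : Finset J, x ∈ regionAlg β (F : Set J) := by
  classical
  induction hx using Algebra.adjoin_induction with
  | mem x hx =>
    obtain ⟨j, -, a, rfl⟩ := hx
    exact ⟨{j}, map_mem_regionAlg (by simp) a⟩
  | algebraMap r => exact ⟨∅, Subalgebra.algebraMap_mem _ r⟩
  | add x y _ _ h h' =>
    obtain ⟨F, hF⟩ := h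
    obtain ⟨F', hF'⟩ := h'
    exact ⟨F ∪ F', add_mem (regionAlg_mono (by simp) hF) (regionAlg_mono (by simp) hF')⟩
  | mul x y _ _ h h' =>
    obtain ⟨F, hF⟩ := h
    obtain ⟨F', hF'⟩ := h'
    exact ⟨F ∪ F', mul_mem (regionAlg_mono (by simp) hF) (regionAlg_mono (by simp) hF')⟩

end Region

/-! ### Quasi-local algebras and the commutant of all sites but one -/

section QuasiLocal

variable {A m J : Type} [CStarAlgebra A] [Fintype m] [DecidableEq m]
  {β : J → Matrix m m ℂ →⋆ₐ[ℂ] A}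

/-- Commuting matrix algebras attached to the sites of a lattice that together generate a dense
subalgebra. -/
structure IsQuasiLocal (β : J → Matrix m m ℂ →⋆ₐ[ℂ] A) : Prop where
  commute : ∀ i j, i ≠ j → ∀ a b, Commute (β i a) (β j b)
  dense : ∀ x, x ∈ closure (regionAlg β Set.univ : Set A)

namespace IsQuasiLocal

variable (hβ : IsQuasiLocal β)
include hβ

theorem commute_map_regionAlg {G : Set J} {j : J} (hj : j ∉ G) {x : A} (hx : x ∈ regionAlg β G)
    (a : Matrix m m ℂ) : Commute (β j a) x :=
  (commute_regionAlg (fun i hi b => hβ.commute i j (fun h => hj (h ▸ hi)) b a) hx).symm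

/-- On the generators, slicing at `j` turns operators at `j` into scalars and leaves or kills the
others; `slice_mul` carries this over to products. -/
theorem slice_mem_regionAlg {G : Set J} {j : J} (hj : j ∉ G) {x : A}
    (hx : x ∈ regionAlg β (insert j G)) (a b : m) : slice (β j) a b x ∈ regionAlg β G := by
  have hc : ∀ y ∈ regionAlg β G, ∀ a b, slice (β j) a b y ∈ regionAlg β G := fun y hy a b => by
    rw [slice_of_commute _ (hβ.commute_map_regionAlg hj hy)]
    split_ifs
    exacts [hy, zero_mem _]
  induction hx using Algebra.adjoin_induction generalizing a b with
  | mem x hx =>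
    obtain ⟨i, hi | hi, y, rfl⟩ := hx
    · subst hi
      rw [← mul_one (β i y), slice_map_mul _ (fun _ => Commute.one_right _)]
      exact Subalgebra.smul_mem _ (one_mem _) _
    · exact hc _ (map_mem_regionAlg hi y) a b
  | algebraMap r => exact hc _ (Subalgebra.algebraMap_mem _ r) a b
  | add x y _ _ h h' => rw [map_add]; exact add_mem (h a b) (h' a b)
  | mul x y _ _ h h' =>
    rw [slice_mul]
    exact sum_mem fun c _ => mul_mem (h a c) (h' c b)

/-- A site whose algebra commutes with `z` can be removed from an approximant of `z` at no cost in
norm: replace `x` by a diagonal slice at that site. -/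
theorem exists_norm_sub_le [Nonempty m] {G : Set J} {j : J} (hj : j ∉ G) {z x : A}
    (hz : ∀ a, Commute (β j a) z) (hx : x ∈ regionAlg β (insert j G)) :
    ∃ y ∈ regionAlg β G, ‖z - y‖ ≤ ‖z - x‖ := by
  obtain ⟨i⟩ := ‹Nonempty m›
  set p := β j (Matrix.single i i 1) with hp
  have hpn : ‖p‖ ≤ 1 := by
    have h1 : ‖p‖ = ‖star p * p‖ := by
      rw [hp, ← map_star, Matrix.star_eq_conjTranspose, Matrix.conjTranspose_single, star_one,
        map_single_mul, if_pos rfl]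
    rw [CStarRing.norm_star_mul_self] at h1
    by_contra! h
    nlinarith
  have hy := hβ.slice_mem_regionAlg hj hx i i
  refine ⟨_, hy, ?_⟩
  have hpp : p * p = p := by rw [hp, map_single_mul, if_pos rfl]
  -- Both sides are compressions by `p`. Since `z` and the slice commute with site `j`, the left
  -- side has the norm of `z - slice` by `norm_mul_single`.
  have h : (z - slice (β j) i i x) * p = p * (z - x) * p := by
    rw [sub_mul, mul_sub, sub_mul, slice_mul_single, (hz _).eq, mul_assoc z, hpp]
  rw [← norm_mul_single (β j) (c := z - slice (β j) i i x)
    (fun a => (hz a).sub_right (commute_slice _ _ _ _ _)) i, ← hp, h]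
  calc ‖p * (z - x) * p‖ ≤ ‖p‖ * ‖z - x‖ * ‖p‖ :=
        (norm_mul_le _ _).trans (mul_le_mul_of_nonneg_right (norm_mul_le _ _) (norm_nonneg _))
    _ ≤ 1 * ‖z - x‖ * 1 := by gcongr
    _ = _ := by ring

theorem exists_norm_sub_le_of_finset [Nonempty m] {G : Set J} (F : Finset J) {z x : A}
    (hFG : ∀ j ∈ F, j ∉ G) (hz : ∀ j ∈ F, ∀ a, Commute (β j a) z)
    (hx : x ∈ regionAlg β (G ∪ F)) : ∃ y ∈ regionAlg β G, ‖z - y‖ ≤ ‖z - x‖ := by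
  classical
  induction F using Finset.induction_on generalizing x with
  | empty => exact ⟨x, by simpa using hx, le_rfl⟩
  | insert j F hj ih =>
    have hjG : j ∉ G ∪ F := by
      rintro (h | h)
      exacts [hFG j (Finset.mem_insert_self _ _) h, hj h]
    have hx' : x ∈ regionAlg β (insert j (G ∪ F)) := by
      convert hx using 2
      simp [Set.union_insert]
    obtain ⟨y, hy, hyx⟩ := hβ.exists_norm_sub_le hjG (hz j (Finset.mem_insert_self _ _)) hx'
    obtain ⟨w, hw, hwy⟩ := ih (fun i hi => hFG i (Finset.mem_insert_of_mem hi))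
      (fun i hi => hz i (Finset.mem_insert_of_mem hi)) hy
    exact ⟨w, hw, hwy.trans hyx⟩

/-- An element commuting with the matrix algebras of all sites but one belongs to the matrix
algebra of that site. -/
theorem mem_range_of_commute [Nonempty m] {i : J} {z : A}
    (hz : ∀ j, j ≠ i → ∀ a, Commute (β j a) z) : ∃ a, β i a = z := by
  classical
  -- Local approximants of `z` can be pushed into the algebra of site `i`, which is
  -- finite-dimensional and hence closed.
  have hcl : IsClosed ((LinearMap.range (β i).toAlgHom.toLinearMap : Submodule ℂ A) : Set A) :=
    Submodule.closed_of_finiteDimensional _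
  have : z ∈ closure ((LinearMap.range (β i).toAlgHom.toLinearMap : Submodule ℂ A) : Set A) := by
    rw [Metric.mem_closure_iff]
    intro ε hε
    obtain ⟨x, hx, hzx⟩ := Metric.mem_closure_iff.1 (hβ.dense z) ε hε
    obtain ⟨F, hF⟩ := exists_finset_mem_regionAlg hx
    obtain ⟨y, hy, hyx⟩ := hβ.exists_norm_sub_le_of_finset (G := {i}) (F.erase i) (z := z) (x := x)
      (fun j hj => Finset.ne_of_mem_erase hj) (fun j hj => hz j (Finset.ne_of_mem_erase hj))
      (regionAlg_mono (by intro j hj; by_cases h : j = i <;> simp_all) hF)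
    refine ⟨y, regionAlg_singleton_le i hy, ?_⟩
    rw [dist_eq_norm] at hzx ⊢
    exact hyx.trans_lt hzx
  rw [hcl.closure_eq] at this
  exact this

end IsQuasiLocal

end QuasiLocal

/-! ### Endomorphisms of matrix algebras are inner -/

section MatrixAut

variable {m : Type} [Fintype m] [DecidableEq m]

/-- Pulls an implementing unitary back from an operator algebra `B` to matrices. The convention
there is `V x V*`, here `W* a W`, so `W` is the adjoint of the matrix of `V`. -/
theorem exists_unitary_of_conj {B : Type} [Ring B] [StarRing B] [Algebra ℂ B]
    (φ : Matrix m m ℂ →⋆ₐ[ℂ] Matrix m m ℂ) (E : Matrix m m ℂ ≃⋆ₐ[ℂ] B) (V : unitary B)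
    (h : ∀ a, E (φ (E.symm (E a))) = V * E a * star (V : B)) :
    ∃ W ∈ Matrix.unitaryGroup m ℂ, ∀ a, φ a = star W * a * W := by
  obtain ⟨X, hX⟩ : ∃ X, E X = V := ⟨E.symm V, E.apply_symm_apply _⟩
  refine ⟨star X, ?_, fun a => EquivLike.injective E ?_⟩
  · rw [Matrix.mem_unitaryGroup_iff]
    apply EquivLike.injective E
    rw [star_star, map_mul, map_star, hX, Unitary.star_mul_self_of_mem V.2, map_one]
  · rw [map_mul, map_mul, map_star, map_star, hX, star_star, ← h, E.symm_apply_apply]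

/-- Every `*`-endomorphism of a full matrix algebra is implemented by a unitary. -/
theorem exists_unitary_of_starAlgHom [Nonempty m] (φ : Matrix m m ℂ →⋆ₐ[ℂ] Matrix m m ℂ) :
    ∃ W ∈ Matrix.unitaryGroup m ℂ, ∀ a, φ a = star W * a * W := by
  -- A full matrix algebra is simple; bijectivity then follows by counting dimensions.
  have hinj : Function.Injective φ.toAlgHom.toLinearMap := φ.toAlgHom.toRingHom.injective
  have hbij : Function.Bijective φ := ⟨hinj, LinearMap.injective_iff_surjective.1 hinj⟩
  let e := StarAlgEquiv.ofBijective φ hbij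
  let E : Matrix m m ℂ ≃⋆ₐ[ℂ] _ := Matrix.toEuclideanCLM (n := m) (𝕜 := ℂ)
  obtain ⟨U, hU⟩ := StarAlgEquiv.eq_linearIsometryEquivConjStarAlgEquiv
    ((E.symm.trans e).trans E) (LinearMap.continuous_of_finiteDimensional
      (((E.symm.trans e).trans E).toAlgEquiv.toLinearMap))
  rw [← Unitary.conjStarAlgAut_symm_unitaryLinearIsometryEquiv] at hU
  set V := Unitary.linearIsometryEquiv.symm U
  exact exists_unitary_of_conj φ E V fun a => congrArg (fun f => f (E a)) hU

end MatrixAut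

/-! ### Infinite products of on-site unitaries -/

section OnSite

variable {A m J : Type} [CStarAlgebra A] [Fintype m] [DecidableEq m]
  {β : J → Matrix m m ℂ →⋆ₐ[ℂ] A}

theorem continuous_starAlgHom {B : Type} [CStarAlgebra B] (f : A →⋆ₐ[ℂ] B) : Continuous f :=
  AddMonoidHomClass.continuous_of_bound f 1 fun x => by
    simpa using NonUnitalStarAlgHom.norm_apply_le f x

/-- A net of `*`-automorphisms that converges pointwise on a dense subset converges to a
`*`-endomorphism. -/
theorem exists_tendsto_starAlgHom {ι : Type} {l : Filter ι} [l.NeBot] (φ : ι → A ≃⋆ₐ[ℂ] A)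
    (h : ∀ x, x ∈ closure {x | ∃ y, Tendsto (fun i => φ i x) l (𝓝 y)}) :
    ∃ w : A →⋆ₐ[ℂ] A, ∀ x, Tendsto (fun i => φ i x) l (𝓝 (w x)) := by
  have hlim : ∀ x, ∃ y, Tendsto (fun i => φ i x) l (𝓝 y) := fun x => by
    rw [← cauchy_map_iff_exists_tendsto, Metric.cauchy_iff]
    refine ⟨inferInstance, fun ε hε => ?_⟩
    obtain ⟨x', ⟨y, hy⟩, hx'⟩ := Metric.mem_closure_iff.1 (h x) (ε / 4) (by positivity)
    have hmem : {i | dist (φ i x') y < ε / 4} ∈ l :=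
      hy (Metric.ball_mem_nhds y (by positivity))
    refine ⟨_, image_mem_map hmem, ?_⟩
    have hd : ∀ i ∈ {i | dist (φ i x') y < ε / 4}, dist (φ i x) y < ε / 2 := fun i hi => by
      calc dist (φ i x) y ≤ dist (φ i x) (φ i x') + dist (φ i x') y := dist_triangle _ _ _
        -- Automorphisms are isometric, so convergence at a nearby `x'` controls `φ i x` uniformly
        -- in `i`.
        _ = dist x x' + dist (φ i x') y := by rw [(StarAlgEquiv.isometry (φ i)).dist_eq]
        _ < ε / 4 + ε / 4 := add_lt_add hx' hi
        _ = ε / 2 := by ring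
    rintro _ ⟨i, hi, rfl⟩ _ ⟨j, hj, rfl⟩
    have := dist_triangle_right (φ i x) (φ j x) y
    linarith [hd i hi, hd j hj]
  choose w hw using hlim
  refine ⟨{ toFun := w, map_one' := ?_, map_mul' := fun x y => ?_, map_zero' := ?_,
            map_add' := fun x y => ?_, commutes' := fun c => ?_, map_star' := fun x => ?_ }, hw⟩
  · exact tendsto_nhds_unique (hw 1) (by simp)
  · exact tendsto_nhds_unique (hw _) (by simpa using (hw x).mul (hw y))
  · exact tendsto_nhds_unique (hw 0) (by simp)
  · exact tendsto_nhds_unique (hw _) (by simpa using (hw x).add (hw y))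
  · exact tendsto_nhds_unique (hw _) (by simp [Algebra.algebraMap_eq_smul_one])
  · exact tendsto_nhds_unique (hw _) (by simpa [map_star] using (hw x).star)

namespace IsQuasiLocal

variable (hβ : IsQuasiLocal β)
include hβ

theorem starAlgHom_ext {B : Type} [CStarAlgebra B] {f g : A →⋆ₐ[ℂ] B}
    (h : ∀ j a, f (β j a) = g (β j a)) : f = g := by
  have hle : regionAlg β Set.univ ≤ AlgHom.equalizer f.toAlgHom g.toAlgHom :=
    regionAlg_le fun j _ a => h j a
  ext x
  exact closure_minimal (fun y hy => hle hy)
    (isClosed_eq (continuous_starAlgHom f) (continuous_starAlgHom g)) (hβ.dense x)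

/-- The unitary is the product of the copies of `W` over `F`. The commutation clause for sites
outside `F` is what lets the induction add a new site. -/
theorem exists_unitary_finset {W : Matrix m m ℂ} (hW : W ∈ Matrix.unitaryGroup m ℂ)
    (F : Finset J) : ∃ U : unitary A,
      (∀ j ∈ F, ∀ a, star (U : A) * β j a * U = β j (star W * a * W)) ∧
      ∀ j ∉ F, ∀ a, Commute (β j a) (U : A) := by
  classical
  induction F using Finset.induction_on with
  | empty => exact ⟨1, by simp, by simp⟩
  | insert i F hi ih =>
    obtain ⟨U, hU, hU'⟩ := ih
    refine ⟨⟨β i W, by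
      rw [Unitary.mem_iff, ← map_star, ← map_mul, ← map_mul, Matrix.mem_unitaryGroup_iff.1 hW,
        Matrix.mem_unitaryGroup_iff'.1 hW]
      simp⟩ * U, fun j hj a => ?_, fun j hj a => ?_⟩
    · rw [Submonoid.coe_mul, star_mul]
      change star (U : A) * star (β i W) * β j a * (β i W * (U : A)) = _
      rw [← map_star]
      by_cases hji : j = i
      · subst hji
        have : star (U : A) * β j (star W) * β j a * (β j W * (U : A)) =
            star (U : A) * (β j (star W * a * W) * (U : A)) := by
          rw [map_mul, map_mul]
          simp only [mul_assoc]
        rw [this, (hU' j hi _).eq, ← mul_assoc, Unitary.star_mul_self_of_mem U.2, one_mul]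
      · have hjF : j ∈ F := (Finset.mem_insert.1 hj).resolve_left hji
        have : star (U : A) * β i (star W) * β j a * (β i W * (U : A)) =
            star (U : A) * β j a * U := by
          rw [mul_assoc (star (U : A)), (hβ.commute i j (Ne.symm hji) _ _).eq, mul_assoc,
            mul_assoc (β j a), ← mul_assoc (β i _), ← map_mul,
            Matrix.mem_unitaryGroup_iff'.1 hW, map_one, one_mul, mul_assoc]
        rw [this, hU j hjF]
    · rw [Finset.mem_insert, not_or] at hj
      exact (hβ.commute j i hj.1 _ _).mul_right (hU' j hj.2 a)

/-- The infinite product of unitaries need not exist in `A`, but conjugation by the finite products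
converges pointwise: on each generator the net is eventually constant. -/
theorem exists_onSite_hom {W : Matrix m m ℂ} (hW : W ∈ Matrix.unitaryGroup m ℂ) :
    ∃ w : A →⋆ₐ[ℂ] A, ∀ j a, w (β j a) = β j (star W * a * W) := by
  classical
  choose U hU _ using hβ.exists_unitary_finset hW
  let φ : Finset J → A ≃⋆ₐ[ℂ] A := fun F => Unitary.conjStarAlgAut ℂ A (star (U F))
  have hφ : ∀ F x, φ F x = star (U F : A) * x * U F := fun F x =>
    Unitary.conjStarAlgAut_star_apply _ _
  have hgen : ∀ j a, Tendsto (fun F => φ F (β j a)) atTop (𝓝 (β j (star W * a * W))) :=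
    fun j a => tendsto_const_nhds.congr' <| by
      filter_upwards [eventually_ge_atTop {j}] with F hF
      rw [hφ, hU F j (hF (Finset.mem_singleton_self j))]
  have hreg : ∀ x ∈ regionAlg β Set.univ, ∃ y, Tendsto (fun F => φ F x) atTop (𝓝 y) := by
    intro x hx
    induction hx using Algebra.adjoin_induction with
    | mem x hx =>
      obtain ⟨j, -, a, rfl⟩ := hx
      exact ⟨_, hgen j a⟩
    | algebraMap r => exact ⟨r • 1, by simp [Algebra.algebraMap_eq_smul_one]⟩
    | add x y _ _ h h' =>
      obtain ⟨x', hx'⟩ := h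
      obtain ⟨y', hy'⟩ := h'
      exact ⟨x' + y', by simpa using hx'.add hy'⟩
    | mul x y _ _ h h' =>
      obtain ⟨x', hx'⟩ := h
      obtain ⟨y', hy'⟩ := h'
      exact ⟨x' * y', by simpa using hx'.mul hy'⟩
  obtain ⟨w, hw⟩ := exists_tendsto_starAlgHom (l := atTop) φ
    fun x => closure_mono hreg (hβ.dense x)
  exact ⟨w, fun j a => tendsto_nhds_unique (hw _) (hgen j a)⟩

/-- The product of identical on-site unitaries defines an automorphism, also if the lattice is
infinite. -/
theorem exists_onSite {W : Matrix m m ℂ} (hW : W ∈ Matrix.unitaryGroup m ℂ) :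
    ∃ w : A ≃⋆ₐ[ℂ] A, ∀ j a, w (β j a) = β j (star W * a * W) := by
  obtain ⟨w, hw⟩ := hβ.exists_onSite_hom hW
  obtain ⟨w', hw'⟩ := hβ.exists_onSite_hom (Unitary.star_mem hW)
  have h1 := Matrix.mem_unitaryGroup_iff.1 hW
  have h2 := Matrix.mem_unitaryGroup_iff'.1 hW
  refine ⟨StarAlgEquiv.ofStarAlgHom w w' (hβ.starAlgHom_ext fun j a => ?_)
    (hβ.starAlgHom_ext fun j a => ?_), hw⟩
  · change w' (w (β j a)) = β j a
    rw [hw, hw', star_star]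
    congr 1
    calc W * (star W * a * W) * star W = (W * star W) * a * (W * star W) := by noncomm_ring
      _ = a := by rw [h1, one_mul, mul_one]
  · change w (w' (β j a)) = β j a
    rw [hw', hw, star_star]
    congr 1
    calc star W * (W * a * star W) * W = (star W * W) * a * (star W * W) := by noncomm_ring
      _ = a := by rw [h2, one_mul, mul_one]

end IsQuasiLocal

end OnSite

/-! ### Tensor factorizations into commuting subalgebras -/

section Factorization

variable {A m : Type} [Ring A] [StarRing A] [Algebra ℂ A] [StarModule ℂ A] [Fintype m] [DecidableEq m]

theorem exists_lift_of_mem_range [Nontrivial A] (β : Matrix m m ℂ →⋆ₐ[ℂ] A)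
    {S : Type} [Ring S] [StarRing S] [Algebra ℂ S] (f : S →⋆ₐ[ℂ] A)
    (h : ∀ s, f s ∈ β.range) : ∃ T : S →⋆ₐ[ℂ] Matrix m m ℂ, ∀ s, β (T s) = f s := by
  refine ⟨((StarAlgEquiv.ofInjective β (map_injective β)).symm : _ →⋆ₐ[ℂ] _).comp
    (f.codRestrict _ h), fun s => ?_⟩
  exact congrArg Subtype.val ((StarAlgEquiv.ofInjective β (map_injective β)).apply_symm_apply
    (f.codRestrict _ h s))

end Factorization

section Factorization

variable {A m : Type} [Ring A] [StarRing A] [Algebra ℂ A] [StarModule ℂ A] [Fintype m] [DecidableEq m]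

/-- The slices relative to `β` recover the tensor: a matrix times an element of its commutant has
the entries of the matrix times that element as coefficients. -/
theorem mulMap_injective_of_commute [Nontrivial A] (β : Matrix m m ℂ →⋆ₐ[ℂ] A)
    {M : Type} [Ring M] [StarRing M] [Algebra ℂ M] [StarModule ℂ M] {φ : M →⋆ₐ[ℂ] A}
    (hφ : Function.Injective φ) (P Q : StarSubalgebra ℂ M) (hP : ∀ p ∈ P, φ p ∈ β.range)
    (hQ : ∀ q ∈ Q, ∀ a, Commute (β a) (φ q)) :
    Function.Injective (Submodule.mulMap (Subalgebra.toSubmodule P.toSubalgebra)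
        (Subalgebra.toSubmodule Q.toSubalgebra)) := by
  obtain ⟨T, hT⟩ := exists_lift_of_mem_range β (φ.comp P.subtype) fun s => hP s s.2
  let T' : Subalgebra.toSubmodule P.toSubalgebra →ₗ[ℂ] Matrix m m ℂ := T.toAlgHom.toLinearMap
  let φ' : Subalgebra.toSubmodule Q.toSubalgebra →ₗ[ℂ] A :=
    φ.toAlgHom.toLinearMap ∘ₗ Submodule.subtype _
  have hT' : Function.Injective T' := fun x y hxy => by
    have : φ x = φ y := by
      have h1 := hT x
      have h2 := hT y
      have h3 : T x = T y := hxy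
      rw [h3] at h1
      exact h1.symm.trans h2
    exact Subtype.ext (hφ this)
  have hφ' : Function.Injective φ' := hφ.comp Subtype.val_injective
  -- This undoes multiplication: composed with the product map it becomes `T' ⊗ φ'`, which is
  -- injective because everything is flat over ℂ.
  let Ψ : A →ₗ[ℂ] Matrix m m ℂ ⊗[ℂ] A :=
    ∑ a, ∑ b, TensorProduct.mk ℂ (Matrix m m ℂ) A (Matrix.single a b 1) ∘ₗ slice β a b
  have hΨ : Ψ ∘ₗ φ.toAlgHom.toLinearMap ∘ₗ Submodule.mulMap
      (Subalgebra.toSubmodule P.toSubalgebra) (Subalgebra.toSubmodule Q.toSubalgebra) =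
      TensorProduct.map T' φ' := by
    ext p q
    have hpq : φ ((p : M) * (q : M)) = β (T p) * φ q := by rw [map_mul, hT]; rfl
    change Ψ (φ ((p : M) * (q : M))) = T p ⊗ₜ φ q
    rw [hpq]
    simp only [Ψ, LinearMap.sum_apply, LinearMap.comp_apply, TensorProduct.mk_apply,
      slice_map_mul β (hQ q q.2)]
    conv_rhs => rw [Matrix.matrix_eq_sum_single (T p)]
    simp only [TensorProduct.sum_tmul, ← TensorProduct.smul_tmul, Matrix.smul_single]
    simp
  have hinj := TensorProduct.map_injective_of_flat_flat T' φ' hT' hφ'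
  rw [← hΨ] at hinj
  exact Function.Injective.of_comp (f := Ψ ∘ φ) hinj

/-- A pair of `*`-homomorphisms with commuting ranges on the two tensor factors of a `*`-algebra
extends to the whole algebra. -/
theorem exists_starAlgHom_of_mulMap_bijective {M N : Type} [Ring M] [StarRing M] [Algebra ℂ M]
    [StarModule ℂ M] [Ring N] [StarRing N] [Algebra ℂ N] {P Q : StarSubalgebra ℂ M}
    (hPQ : ∀ a ∈ P, ∀ b ∈ Q, Commute a b)
    (hbij : Function.Bijective (Submodule.mulMap (Subalgebra.toSubmodule P.toSubalgebra)
        (Subalgebra.toSubmodule Q.toSubalgebra)))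
    (T₁ : P →⋆ₐ[ℂ] N) (T₂ : Q →⋆ₐ[ℂ] N) (hT : ∀ p q, Commute (T₁ p) (T₂ q)) :
    ∃ Φ : M →⋆ₐ[ℂ] N, (∀ p : P, Φ p = T₁ p) ∧ ∀ q : Q, Φ q = T₂ q := by
  let μ : P ⊗[ℂ] Q →ₐ[ℂ] M := Algebra.TensorProduct.lift P.subtype.toAlgHom Q.subtype.toAlgHom
    fun a b => hPQ a a.2 b b.2
  have hμ : Function.Bijective μ := hbij
  let e := AlgEquiv.ofBijective μ hμ
  let ν : P ⊗[ℂ] Q →ₐ[ℂ] N := Algebra.TensorProduct.lift T₁.toAlgHom T₂.toAlgHom hT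
  have he : ∀ (p : P) (q : Q), e.symm (p * q) = p ⊗ₜ q := fun p q => by
    rw [AlgEquiv.symm_apply_eq]
    rfl
  have hν : ∀ (p : P) (q : Q), ν (e.symm (p * q)) = T₁ p * T₂ q := fun p q => by
    rw [he]
    rfl
  have hstar : ∀ x, ν (e.symm (star x)) = star (ν (e.symm x)) := fun x => by
    obtain ⟨y, rfl⟩ := e.surjective x
    induction y with
    | zero => simp
    | add y z hy hz => simp only [map_add, star_add, hy, hz]
    | tmul p q =>
      have h1 : e (p ⊗ₜ q) = p * q := rfl
      -- The adjoint reverses the factors; commutation of `P` with `Q` restores their order.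
      have h2 : star ((p : M) * (q : M)) = (star p : P) * (star q : Q) := by
        rw [(hPQ p p.2 q q.2).eq, star_mul]
        rfl
      rw [h1, h2, hν, hν, (hT p q).eq, star_mul, map_star, map_star]
  refine ⟨{ ν.comp e.symm.toAlgHom with map_star' := hstar }, fun p => ?_, fun q => ?_⟩
  · have := hν p 1
    rw [OneMemClass.coe_one, mul_one, map_one, mul_one] at this
    exact this
  · have := hν 1 q
    rw [OneMemClass.coe_one, one_mul, map_one, one_mul] at this
    exact this

end Factorization

/-! ### The support algebra argument -/

section Transport

variable {A m J : Type} [CStarAlgebra A] [Fintype m] [DecidableEq m]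
  {β : J → Matrix m m ℂ →⋆ₐ[ℂ] A}

/-- The `*`-subalgebra of the operators that `t` takes from the site `s` to the site `i`. -/
noncomputable def transportedAlg (β : J → Matrix m m ℂ →⋆ₐ[ℂ] A) (t : A ≃⋆ₐ[ℂ] A) (s i : J) :
    StarSubalgebra ℂ (Matrix m m ℂ) :=
  (β i).range.comap ((t : A →⋆ₐ[ℂ] A).comp (β s))

namespace IsQuasiLocal

variable (hβ : IsQuasiLocal β)
include hβ

/-- The slice commutes with `t` of every site other than `s`, so its preimage under `t` lies in the
algebra of `s`. Surjectivity of `t` enters here. -/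
theorem exists_slice_eq [Nonempty m] {t : A ≃⋆ₐ[ℂ] A} {s l i : J} (hli : l ≠ i)
    (hs : ∀ a, t (β s a) ∈ regionAlg β {i, l})
    (hn : ∀ n, n ≠ s → ∃ G : Set J, (∀ a, t (β n a) ∈ regionAlg β G) ∧ (l ∉ G ∨ i ∉ G))
    (c : Matrix m m ℂ) (a b : m) :
    ∃ q ∈ transportedAlg β t s l, slice (β i) a b (t (β s c)) = t (β s q) := by
  set x := slice (β i) a b (t (β s c)) with hx
  have hxl : x ∈ regionAlg β {l} := hβ.slice_mem_regionAlg (by simpa using hli.symm) (hs c) a b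
  obtain ⟨q, hq⟩ := hβ.mem_range_of_commute (i := s) (z := t.symm x) fun n hns y => by
    have : Commute (t (β n y)) x := by
      -- If the image of `n` misses `l`, it commutes with the slice because the slice lives on `l`.
      -- If it misses `i`, it commutes both with the matrix units used for slicing and with the
      -- sliced operator.
      obtain ⟨G, hG, h | h⟩ := hn n hns
      · obtain ⟨e, he⟩ := regionAlg_singleton_le l hxl
        rw [← he]
        exact (hβ.commute_map_regionAlg h (hG y) e).symm
      · refine commute_slice_of_commute _ (hβ.commute_map_regionAlg h (hG y)) ?_ _ _
        exact (hβ.commute n s hns y c).map t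
    simpa using this.map t.symm
  have hqx : t (β s q) = x := by rw [hq, t.apply_symm_apply]
  obtain ⟨e, he⟩ := regionAlg_singleton_le l hxl
  exact ⟨q, ⟨e, he.trans hqx.symm⟩, hqx.symm⟩

theorem commute_transportedAlg [Nontrivial A] {t : A ≃⋆ₐ[ℂ] A} {s l i : J} (hli : l ≠ i) :
    ∀ a ∈ transportedAlg β t s l, ∀ b ∈ transportedAlg β t s i, Commute a b := by
  rintro a ⟨a', ha⟩ b ⟨b', hb⟩
  have hab : Commute (t (β s a)) (t (β s b)) := by
    have := hβ.commute l i hli a' b'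
    rwa [show β l a' = t (β s a) from ha, show β i b' = t (β s b) from hb] at this
  apply map_injective (β s)
  apply EquivLike.injective t
  rw [map_mul, map_mul, map_mul, map_mul]
  exact hab

/-- If an automorphism moves each site into two others in a sufficiently disjoint manner, then the
algebra of a site is the tensor product of the parts going to either of the two sites. -/
theorem mulMap_transportedAlg_bijective [Nonempty m] [Nontrivial A] {t : A ≃⋆ₐ[ℂ] A} {s l i : J}
    (hli : l ≠ i) (hs : ∀ a, t (β s a) ∈ regionAlg β {i, l})
    (hn : ∀ n, n ≠ s → ∃ G : Set J, (∀ a, t (β n a) ∈ regionAlg β G) ∧ (l ∉ G ∨ i ∉ G)) :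
    Function.Bijective (Submodule.mulMap
      (Subalgebra.toSubmodule (transportedAlg β t s l).toSubalgebra)
      (Subalgebra.toSubmodule (transportedAlg β t s i).toSubalgebra)) := by
  have htβ : Function.Injective fun a => t (β s a) :=
    (EquivLike.injective t).comp (map_injective (β s))
  refine ⟨mulMap_injective_of_commute (β l) (φ := (t : A →⋆ₐ[ℂ] A).comp (β s)) htβ _ _
    (fun p hp => hp) ?_, fun c => ?_⟩
  · rintro q ⟨q', hq⟩ a
    have := hβ.commute l i hli a q'
    rwa [show β i q' = t (β s q) from hq] at this
  -- `R` consists of the operators at `l` that lie in the image of site `s`. Slicing at `i` places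
  -- `t (β s c)` in R ⊗ B_i, slicing at `l` in B_l ⊗ t(Q). A linear projection `π` onto `R`, applied
  -- to the `l` factor of the second expansion, combines the two.
  let R : Submodule ℂ (Matrix m m ℂ) :=
    (LinearMap.range (((t : A →⋆ₐ[ℂ] A).comp (β s)).toAlgHom.toLinearMap)).comap
      (β l).toAlgHom.toLinearMap
  obtain ⟨π, hπ⟩ := LinearMap.exists_leftInverse_of_injective R.subtype (Submodule.ker_subtype R)
  have hπR : ∀ x ∈ R, (π x : Matrix m m ℂ) = x := fun x hx =>
    congrArg Subtype.val (LinearMap.congr_fun hπ ⟨x, hx⟩)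
  let proj : A →ₗ[ℂ] A := ∑ a, ∑ b,
    LinearMap.mulLeft ℂ (β l (π (Matrix.single a b 1))) ∘ₗ slice (β l) a b
  have hproj : ∀ z, proj z = ∑ a, ∑ b, β l (π (Matrix.single a b 1)) * slice (β l) a b z := fun z => by
    simp [proj]
  have hprojmul : ∀ x ∈ R, ∀ y, proj (β l x * β i y) = β l x * β i y := fun x hx y => by
    rw [hproj]
    simp only [slice_map_mul (β l) (fun e => hβ.commute l i hli e y)]
    conv_rhs => rw [← hπR x hx]
    conv_rhs => rw [Matrix.matrix_eq_sum_single x]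
    simp only [map_sum, Submodule.coe_sum, Finset.sum_mul]
    refine Finset.sum_congr rfl fun a _ => Finset.sum_congr rfl fun b _ => ?_
    rw [show Matrix.single a b (x a b) = x a b • Matrix.single a b (1 : ℂ) by
      simp [Matrix.smul_single], map_smul, Submodule.coe_smul, map_smul, smul_mul_assoc,
      mul_smul_comm]
  -- The coefficients relative to site `i` lie in the image of `R`, which `proj` leaves alone.
  have hz : proj (t (β s c)) = t (β s c) := by
    conv_lhs => rw [← sum_slice_mul_single (β i) (t (β s c))]
    conv_rhs => rw [← sum_slice_mul_single (β i) (t (β s c))]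
    simp only [map_sum]
    refine Finset.sum_congr rfl fun a _ => Finset.sum_congr rfl fun b _ => ?_
    obtain ⟨q, ⟨x, hx⟩, hq⟩ := hβ.exists_slice_eq hli hs hn c a b
    have hx' : β l x = t (β s q) := hx
    rw [hq, ← hx']
    exact hprojmul x ⟨q, hx'.symm⟩ _
  have hP : ∀ a b, ∃ p ∈ transportedAlg β t s l, β l (π (Matrix.single a b 1)) = t (β s p) :=
    fun a b => by
      obtain ⟨p, hp⟩ := (π (Matrix.single a b 1)).2
      exact ⟨p, ⟨_, hp.symm⟩, hp.symm⟩
  have hQ : ∀ a b, ∃ q ∈ transportedAlg β t s i, slice (β l) a b (t (β s c)) = t (β s q) :=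
    fun a b => hβ.exists_slice_eq hli.symm (by simpa [Set.pair_comm] using hs)
      (fun n h => by simpa only [or_comm] using hn n h) c a b
  choose p hp hp' using hP
  choose q hq hq' using hQ
  refine ⟨∑ a, ∑ b, ⟨p a b, hp a b⟩ ⊗ₜ ⟨q a b, hq a b⟩, htβ ?_⟩
  change t (β s _) = t (β s c)
  rw [← hz, hproj]
  simp only [map_sum, Submodule.mulMap_tmul, map_mul, hp', hq']

/-- A translation-invariant automorphism that moves every site into itself and the preceding site is
a partial shift followed by identical on-site unitaries. -/
theorem exists_onSite_comp_shift [Nonempty m] [Nontrivial A] [AddGroup J] [One J]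
    (h1 : (1 : J) ≠ 0) (h2 : (1 + 1 : J) ≠ 0) {t : A ≃⋆ₐ[ℂ] A}
    (ht : ∀ n a, t (β n a) ∈ regionAlg β {n, n - 1})
    (hτ : ∀ n, ∃ τ : A ≃⋆ₐ[ℂ] A, (∀ i a, τ (β i a) = β (n + i) a) ∧ ∀ x, t (τ x) = τ (t x)) :
    ∃ W ∈ Matrix.unitaryGroup m ℂ, ∃ w sr : A ≃⋆ₐ[ℂ] A,
      (∀ n a, w (β n a) = β n (star W * a * W)) ∧ (∀ x, t x = w (sr x)) ∧
      ∃ P Q : StarSubalgebra ℂ (Matrix m m ℂ), (∀ a ∈ P, ∀ b ∈ Q, Commute a b) ∧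
        Function.Bijective (Submodule.mulMap (Subalgebra.toSubmodule P.toSubalgebra)
          (Subalgebra.toSubmodule Q.toSubalgebra)) ∧
        (∀ n, ∀ a ∈ P, sr (β n a) = β (n - 1) a) ∧ ∀ n, ∀ b ∈ Q, sr (β n b) = β n b := by
  have hli : (-1 : J) ≠ 0 := neg_ne_zero.2 h1
  have hs : ∀ a, t (β 0 a) ∈ regionAlg β {0, -1} := fun a => by simpa using ht 0 a
  have hn : ∀ n, n ≠ 0 → ∃ G : Set J, (∀ a, t (β n a) ∈ regionAlg β G) ∧
      ((-1 : J) ∉ G ∨ (0 : J) ∉ G) := fun n hn => by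
    refine ⟨_, ht n, ?_⟩
    -- The images of sites 0 and -1 are the only ones that may reach site -1. The image of -1
    -- occupies -1 and -2, and -2 differs from 0 by `h2`: this is where a ring of two sites is
    -- excluded.
    by_cases h : n = -1
    · right
      subst h
      rintro (h | h)
      · exact hli h.symm
      · refine h2 ?_
        rw [Set.mem_singleton_iff, eq_comm, sub_eq_zero] at h
        nth_rw 1 [← h]
        exact neg_add_cancel 1
    · left
      simp [sub_eq_add_neg, Ne.symm h, hn]
  have hPQ := hβ.commute_transportedAlg (t := t) (s := 0) hli
  have hbij := hβ.mulMap_transportedAlg_bijective hli hs hn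
  set P := transportedAlg β t 0 (-1) with hP
  set Q := transportedAlg β t 0 0 with hQ
  obtain ⟨T₁, hT₁⟩ := exists_lift_of_mem_range (β (-1))
    (((t : A →⋆ₐ[ℂ] A).comp (β 0)).comp P.subtype) fun p => p.2
  obtain ⟨T₂, hT₂⟩ := exists_lift_of_mem_range (β 0)
    (((t : A →⋆ₐ[ℂ] A).comp (β 0)).comp Q.subtype) fun q => q.2
  have hT₁' : ∀ n (p : P), t (β n p) = β (n - 1) (T₁ p) := fun n p => by
    obtain ⟨τ, hτ, hτt⟩ := hτ n
    have h := hτ 0 p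
    rw [add_zero] at h
    rw [← h, hτt, sub_eq_add_neg, ← hτ, hT₁]
    rfl
  have hT₂' : ∀ n (q : Q), t (β n q) = β n (T₂ q) := fun n q => by
    obtain ⟨τ, hτ, hτt⟩ := hτ n
    have h := hτ 0 q
    rw [add_zero] at h
    have h' := hτ 0 (T₂ q)
    rw [add_zero] at h'
    rw [← h, hτt, ← h', hT₂]
    rfl
  -- The operator `p` at site 1 and `q` at site 0 commute, and `t` brings both to site 0.
  have hcomm : ∀ p q, Commute (T₁ p) (T₂ q) := fun p q => by
    have := hβ.commute 1 0 h1 p q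
    have := this.map t
    rw [hT₁', hT₂', sub_self] at this
    apply map_injective (β 0)
    rw [map_mul, map_mul]
    exact this
  obtain ⟨Φ, hΦ₁, hΦ₂⟩ := exists_starAlgHom_of_mulMap_bijective hPQ hbij T₁ T₂ hcomm
  obtain ⟨W, hW, hΦW⟩ := exists_unitary_of_starAlgHom Φ
  obtain ⟨w, hw⟩ := hβ.exists_onSite hW
  -- The shift is defined as `t` followed by the inverse of `w`; on `P` and `Q` the unitary cancels,
  -- since `Φ` restricts to `T₁` and `T₂`.
  refine ⟨W, hW, w, t.trans w.symm, hw, fun x => (w.apply_symm_apply _).symm, P, Q, hPQ, hbij,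
    fun n a ha => ?_, fun n a ha => ?_⟩
  · change w.symm (t (β n a)) = _
    rw [hT₁' n ⟨a, ha⟩, ← hΦ₁, hΦW, ← hw, w.symm_apply_apply]
  · change w.symm (t (β n a)) = _
    rw [hT₂' n ⟨a, ha⟩, ← hΦ₂, hΦW, ← hw, w.symm_apply_apply]

end IsQuasiLocal

end Transport

/-! ### Factorization from generators, and transfer to isomorphic algebras -/

section Abstract

variable {A m J : Type} [Ring A] [StarRing A] [Algebra ℂ A] [Fintype m] [DecidableEq m]

theorem starAlgEquiv_mem_of_mem_regionAlg {β : J → Matrix m m ℂ →⋆ₐ[ℂ] A} {B : Type} [Ring B]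
    [StarRing B] [Algebra ℂ B] (f : A ≃⋆ₐ[ℂ] B) {S : Subalgebra ℂ B} {G : Set J}
    (h : ∀ j ∈ G, ∀ a, f (β j a) ∈ S) {x : A} (hx : x ∈ regionAlg β G) : f x ∈ S := by
  have : regionAlg β G ≤ S.comap (f : A →⋆ₐ[ℂ] B).toAlgHom := regionAlg_le h
  exact this hx

/-- If the algebra of a site is generated by operators that `s` either moves to another site or
leaves in place, then it is the tensor product of the operators moved and the operators fixed. -/
theorem exists_factorization_of_generators [StarModule ℂ A] [Nontrivial A] {β₀ β₁ : Matrix m m ℂ →⋆ₐ[ℂ] A}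
    (hβ : ∀ a b, Commute (β₁ a) (β₀ b)) (s : A ≃⋆ₐ[ℂ] A) {T : Set A}
    (hT : ∀ a, β₀ a ∈ Algebra.adjoin ℂ T)
    (h : ∀ x ∈ T, ∃ b, β₀ b = x ∧ (s (β₀ b) = β₁ b ∨ s (β₀ b) = β₀ b)) :
    ∃ P Q : StarSubalgebra ℂ (Matrix m m ℂ), (∀ a ∈ P, ∀ b ∈ Q, Commute a b) ∧
      Function.Bijective (Submodule.mulMap (Subalgebra.toSubmodule P.toSubalgebra)
        (Subalgebra.toSubmodule Q.toSubalgebra)) ∧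
      (∀ a ∈ P, s (β₀ a) = β₁ a) ∧ ∀ b ∈ Q, s (β₀ b) = β₀ b := by
  let P := StarAlgHom.equalizer ((s : A →⋆ₐ[ℂ] A).comp β₀) β₁
  let Q := StarAlgHom.equalizer ((s : A →⋆ₐ[ℂ] A).comp β₀) β₀
  have hP : ∀ a ∈ P, s (β₀ a) = β₁ a := fun a ha => ha
  have hQ : ∀ a ∈ Q, s (β₀ a) = β₀ a := fun a ha => ha
  have hinj : Function.Injective fun a => s (β₀ a) :=
    (EquivLike.injective s).comp (map_injective β₀)
  have hcomm : ∀ a ∈ P, ∀ b ∈ Q, Commute a b := by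
    intro a ha b hb
    -- `s` separates the two factors into different sites, so their images commute.
    apply hinj
    simp only [map_mul]
    rw [hP a ha, hQ b hb]
    exact hβ a b
  refine ⟨P, Q, hcomm, ⟨?_, fun c => ?_⟩, hP, hQ⟩
  · refine mulMap_injective_of_commute β₁ (φ := (s : A →⋆ₐ[ℂ] A).comp β₀) hinj _ _
      (fun p hp => ⟨p, (hP p hp).symm⟩) fun q hq a => ?_
    change Commute _ (s (β₀ q))
    rw [hQ q hq]
    exact hβ a q
  · let μ := Algebra.TensorProduct.lift P.subtype.toAlgHom Q.subtype.toAlgHom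
      fun a b => hcomm a a.2 b b.2
    -- The image of P ⊗ Q is a subalgebra, so it suffices that it contains the generators, each of
    -- which is in `P` or in `Q`.
    have hle : Algebra.adjoin ℂ T ≤ μ.range.map β₀.toAlgHom := by
      refine Algebra.adjoin_le fun x hx => ?_
      obtain ⟨b, hb, hbP | hbQ⟩ := h x hx
      · exact ⟨b, ⟨(⟨b, hbP⟩ : P) ⊗ₜ 1, mul_one b⟩, hb⟩
      · exact ⟨b, ⟨1 ⊗ₜ (⟨b, hbQ⟩ : Q), one_mul b⟩, hb⟩
    obtain ⟨b, ⟨z, hz⟩, hb⟩ := hle (hT c)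
    exact ⟨z, hz.trans (map_injective _ hb)⟩

/-- The decomposition of an automorphism into a partial shift and identical on-site unitaries, for
a `*`-algebra identified with a C*-algebra. -/
theorem exists_onSite_comp_shift_of_equiv [Nonempty m] [Nontrivial A] [AddGroup J] [One J]
    {C : Type} [CStarAlgebra C] (θ : A ≃⋆ₐ[ℂ] C) {β : J → Matrix m m ℂ →⋆ₐ[ℂ] A}
    (hcomm : ∀ i j, i ≠ j → ∀ a b, Commute (β i a) (β j b))
    (hdense : ∀ x, θ x ∈ closure (θ '' regionAlg β Set.univ))
    (h1 : (1 : J) ≠ 0) (h2 : (1 + 1 : J) ≠ 0) {t : A ≃⋆ₐ[ℂ] A}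
    (ht : ∀ n a, t (β n a) ∈ regionAlg β {n, n - 1})
    (hτ : ∀ n, ∃ τ : A ≃⋆ₐ[ℂ] A, (∀ i a, τ (β i a) = β (n + i) a) ∧ ∀ x, t (τ x) = τ (t x)) :
    ∃ W ∈ Matrix.unitaryGroup m ℂ, ∃ w sr : A ≃⋆ₐ[ℂ] A,
      (∀ n a, w (β n a) = β n (star W * a * W)) ∧ (∀ x, t x = w (sr x)) ∧
      ∃ P Q : StarSubalgebra ℂ (Matrix m m ℂ), (∀ a ∈ P, ∀ b ∈ Q, Commute a b) ∧
        Function.Bijective (Submodule.mulMap (Subalgebra.toSubmodule P.toSubalgebra)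
          (Subalgebra.toSubmodule Q.toSubalgebra)) ∧
        (∀ n, ∀ a ∈ P, sr (β n a) = β (n - 1) a) ∧ ∀ n, ∀ b ∈ Q, sr (β n b) = β n b := by
  have : Nontrivial C := (EquivLike.injective θ).nontrivial
  let γ : J → Matrix m m ℂ →⋆ₐ[ℂ] C := fun j => (θ : A →⋆ₐ[ℂ] C).comp (β j)
  have hγ : ∀ j a, γ j a = θ (β j a) := fun _ _ => rfl
  have hregion : ∀ {G : Set J} {x}, x ∈ regionAlg β G → θ x ∈ regionAlg γ G :=
    starAlgEquiv_mem_of_mem_regionAlg θ fun j hj a => map_mem_regionAlg (β := γ) hj a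
  have hql : IsQuasiLocal γ := by
    refine ⟨fun i j hij a b => (hcomm i j hij a b).map θ, fun x => ?_⟩
    rw [← θ.apply_symm_apply x]
    refine closure_mono ?_ (hdense _)
    rintro _ ⟨y, hy, rfl⟩
    exact hregion hy
  obtain ⟨W, hW, w, sr, hw, hsr, P, Q, hPQ, hbij, hP, hQ⟩ :=
    hql.exists_onSite_comp_shift h1 h2 (t := (θ.symm.trans t).trans θ)
    (fun n a => by
      simpa only [StarAlgEquiv.trans_apply, hγ, θ.symm_apply_apply] using hregion (ht n a))
    (fun n => by
      obtain ⟨τ, hτ, hτt⟩ := hτ n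
      refine ⟨(θ.symm.trans τ).trans θ, fun i a => ?_, fun x => ?_⟩
      · simp only [StarAlgEquiv.trans_apply, hγ, θ.symm_apply_apply, hτ]
      · simp only [StarAlgEquiv.trans_apply, θ.symm_apply_apply, hτt])
  refine ⟨W, hW, (θ.trans w).trans θ.symm, (θ.trans sr).trans θ.symm, fun n a => ?_, fun x => ?_,
    P, Q, hPQ, hbij, fun n a ha => ?_, fun n a ha => ?_⟩
  · simp only [StarAlgEquiv.trans_apply, ← hγ, hw]
    rw [hγ, θ.symm_apply_apply]
  · have := hsr (θ x)
    simp only [StarAlgEquiv.trans_apply, θ.symm_apply_apply, θ.apply_symm_apply] at this ⊢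
    rw [← this, θ.symm_apply_apply]
  · simp only [StarAlgEquiv.trans_apply, ← hγ, hP n a ha]
    rw [hγ, θ.symm_apply_apply]
  · simp only [StarAlgEquiv.trans_apply, ← hγ, hQ n a ha]
    rw [hγ, θ.symm_apply_apply]

end Abstract

/-! ### Local operators on configurations -/

section LocalOperators

variable {ι : Type} {d : ℕ}

theorem nontrivial_obsAlg (hd : 0 < d) : Nontrivial (obsAlg ι d) := by
  refine ⟨0, 1, fun h => ?_⟩
  have h' : (0 : L2 (Config ι d) →L[ℂ] L2 (Config ι d)) = 1 := congrArg Subtype.val h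
  let x : Config ι d := fun _ => ⟨0, hd⟩
  classical
  have := congrArg (fun T => (T (lp.single 2 x (1 : ℂ)) : Config ι d → ℂ) x) h'
  simp at this

theorem localOp_apply {k : ℕ} (e : Fin k ↪ ι) (a : Matrix (Fin k → Fin d) (Fin k → Fin d) ℂ)
    (ψ : L2 (Config ι d)) (x : Config ι d) :
    localOp e a ψ x = ∑ y, a (x ∘ e) y * ψ (Function.extend e y x) :=
  localOpFun_apply e a ψ x

theorem extend_comp_of_disjoint {k l : ℕ} {e : Fin k ↪ ι} {e' : Fin l ↪ ι}
    (h : Disjoint (Set.range e) (Set.range e')) (y : Fin k → Fin d) (x : Config ι d) :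
    Function.extend e y x ∘ e' = x ∘ e' := by
  funext i
  exact Function.extend_apply' _ _ _ fun ⟨j, hj⟩ =>
    Set.disjoint_left.1 h ⟨j, rfl⟩ ⟨i, hj.symm⟩

theorem extend_comm {k l : ℕ} {e : Fin k ↪ ι} {e' : Fin l ↪ ι}
    (h : Disjoint (Set.range e) (Set.range e')) (y : Fin k → Fin d) (z : Fin l → Fin d)
    (x : Config ι d) :
    Function.extend e' z (Function.extend e y x) = Function.extend e y (Function.extend e' z x) := by
  funext i
  by_cases hi : ∃ j, e j = i
  · obtain ⟨j, rfl⟩ := hi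
    rw [e.injective.extend_apply, Function.extend_apply', e.injective.extend_apply]
    exact fun ⟨j', hj'⟩ => Set.disjoint_left.1 h ⟨j, rfl⟩ ⟨j', hj'⟩
  · rw [Function.extend_apply' y _ i hi]
    by_cases hi' : ∃ j, e' j = i
    · obtain ⟨j, rfl⟩ := hi'
      rw [e'.injective.extend_apply, e'.injective.extend_apply]
    · rw [Function.extend_apply' _ _ _ hi', Function.extend_apply' _ _ _ hi',
        Function.extend_apply' _ _ _ hi]

theorem localObs_commute {k l : ℕ} {e : Fin k ↪ ι} {e' : Fin l ↪ ι}
    (h : Disjoint (Set.range e) (Set.range e')) (a : Matrix (Fin k → Fin d) (Fin k → Fin d) ℂ)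
    (b : Matrix (Fin l → Fin d) (Fin l → Fin d) ℂ) :
    Commute (localObs e a) (localObs e' b) := by
  apply Subtype.ext
  change localOp e a * localOp e' b = localOp e' b * localOp e a
  ext ψ x
  change localOp e a (localOp e' b ψ) x = localOp e' b (localOp e a ψ) x
  simp only [localOp_apply, extend_comp_of_disjoint h, extend_comp_of_disjoint h.symm,
    extend_comm h, Finset.mul_sum]
  rw [Finset.sum_comm]
  exact Finset.sum_congr rfl fun _ _ => Finset.sum_congr rfl fun _ _ => by ring

/-- An operator on a part of the sites `f 0, …, f (k - 1)` is an operator on all of them. -/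
theorem exists_localObs_trans {k l : ℕ} (g : Fin l ↪ Fin k) (f : Fin k ↪ ι)
    (a : Matrix (Fin l → Fin d) (Fin l → Fin d) ℂ) :
    ∃ b, localObs f b = (localObs (g.trans f) a : obsAlg ι d) := by
  classical
  -- The matrix of `a ⊗ 1`: zero unless `y` and `w` agree at the sites outside the range of `g`.
  refine ⟨fun w y => if y = Function.extend g (y ∘ g) w then a (w ∘ g) (y ∘ g) else 0,
    Subtype.ext ?_⟩
  change localOp _ _ = localOp _ _
  ext ψ x
  refine (localOp_apply _ _ _ _).trans (Eq.trans ?_ (localOp_apply _ _ _ _).symm)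
  symm
  refine Fintype.sum_of_injective (fun z => Function.extend g z (x ∘ f)) (fun z z' h => ?_) _ _
    (fun y hy => ?_) (fun z => ?_)
  · rw [← extend_comp g z (x ∘ f), ← extend_comp g z' (x ∘ f)]
    exact congrArg (· ∘ g) h
  · rw [if_neg, zero_mul]
    exact fun h => hy ⟨_, h.symm⟩
  · rw [if_pos (by rw [extend_comp]), extend_comp]
    refine congrArg₂ (· * ·) rfl (congrArg (fun y => ψ y) (funext fun i => ?_))
    by_cases hi : ∃ j, f j = i
    · obtain ⟨j, rfl⟩ := hi
      rw [f.injective.extend_apply]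
      by_cases hj : ∃ j', g j' = j
      · obtain ⟨j', rfl⟩ := hj
        rw [g.injective.extend_apply]
        exact (g.trans f).injective.extend_apply _ _ j'
      · rw [Function.extend_apply' _ _ _ hj, Function.extend_apply']
        · rfl
        · exact fun ⟨j', hj'⟩ => hj ⟨j', f.injective hj'⟩
    · rw [Function.extend_apply' _ _ _ hi, Function.extend_apply']
      exact fun ⟨j', hj'⟩ => hi ⟨g j', hj'⟩

/-- The one-element family consisting of the site `x`. -/
def siteEmb (x : ι) : Fin 1 ↪ ι := ⟨fun _ => x, fun _ _ _ => Subsingleton.elim _ _⟩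

/-- The matrix algebra of a site. -/
noncomputable def siteObs (d : ℕ) (x : ι) :
    Matrix (Fin 1 → Fin d) (Fin 1 → Fin d) ℂ →⋆ₐ[ℂ] obsAlg ι d :=
  localObs (siteEmb x)

theorem isLocalizedOn_siteObs (x : ι) (a : Matrix (Fin 1 → Fin d) (Fin 1 → Fin d) ℂ) :
    IsLocalizedOn {x} (siteObs d x a) :=
  ⟨1, siteEmb x, a, by rintro _ ⟨_, rfl⟩; rfl, rfl⟩

theorem exists_localObs_eq_siteObs {k : ℕ} (e : Fin k ↪ ι) (i : Fin k)
    (a : Matrix (Fin 1 → Fin d) (Fin 1 → Fin d) ℂ) : ∃ b, localObs e b = siteObs d (e i) a :=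
  exists_localObs_trans (siteEmb i) e a

theorem permAut_siteObs (g : Equiv.Perm ι) (x : ι)
    (a : Matrix (Fin 1 → Fin d) (Fin 1 → Fin d) ℂ) :
    permAut d g (siteObs d x a) = siteObs d (g x) a :=
  permAut_localObs g _ a

/-- A matrix unit on several sites is a product of one-site matrix units. Splitting off the first
site lets induction place every local operator in the algebra generated by single sites. -/
theorem localObs_single_mul {k : ℕ} (e : Fin (k + 1) ↪ ι) (w y : Fin (k + 1) → Fin d) :
    localObs e (Matrix.single w y 1) =
      siteObs d (e 0) (Matrix.single (fun _ => w 0) (fun _ => y 0) 1) *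
        localObs ((Fin.succEmb k).trans e)
          (Matrix.single (Fin.tail w) (Fin.tail y) 1) := by
  classical
  have hdisj : Disjoint (Set.range (siteEmb (e 0)))
      (Set.range ((Fin.succEmb k).trans e)) := by
    rw [Set.disjoint_left]
    rintro _ ⟨_, rfl⟩ ⟨j, hj⟩
    exact Fin.succ_ne_zero j (e.injective hj)
  apply Subtype.ext
  change localOp _ _ = localOp _ _ * localOp _ _
  ext ψ x
  change _ = localOp _ _ (localOp _ _ ψ) x
  simp only [localOp_apply, extend_comp_of_disjoint hdisj]
  simp only [Matrix.single_apply, ite_and, ite_mul, zero_mul, one_mul]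
  simp only [Finset.sum_ite_irrel, Finset.sum_ite_eq, Finset.mem_univ, if_true,
    Finset.sum_const_zero]
  have h1 : (w = x ∘ e) ↔ ((fun _ => w 0) = x ∘ siteEmb (e 0)) ∧
      Fin.tail w = x ∘ ((Fin.succEmb k).trans e) := by
    constructor
    · rintro rfl
      exact ⟨rfl, rfl⟩
    · rintro ⟨h, h'⟩
      funext i
      refine Fin.cases (congrFun h 0) (fun j => congrFun h' j) i
  have h2 : Function.extend e y x =
      Function.extend ((Fin.succEmb k).trans e) (Fin.tail y)
        (Function.extend (siteEmb (e 0)) (fun _ => y 0) x) := by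
    funext i
    by_cases hi : ∃ j, e j = i
    · obtain ⟨j, rfl⟩ := hi
      rw [e.injective.extend_apply]
      refine Fin.cases ?_ (fun j => ?_) j
      · rw [extend_comm hdisj]
        exact ((siteEmb (e 0)).injective.extend_apply (fun _ => y 0) _ 0).symm
      · exact (((Fin.succEmb k).trans e).injective.extend_apply (Fin.tail y) _ j).symm
    · rw [Function.extend_apply' _ _ _ hi, Function.extend_apply', Function.extend_apply']
      · exact fun ⟨_, hj⟩ => hi ⟨0, hj⟩
      · exact fun ⟨j, hj⟩ => hi ⟨j.succ, hj⟩
  rw [h2, if_congr h1 rfl rfl, ite_and]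

theorem localObs_mem_regionAlg {k : ℕ} (e : Fin k ↪ ι)
    (a : Matrix (Fin k → Fin d) (Fin k → Fin d) ℂ) :
    localObs e a ∈ regionAlg (siteObs d) (Set.range e) := by
  have key : ∀ w y, localObs e (Matrix.single w y (1 : ℂ)) ∈
      regionAlg (siteObs d) (Set.range e) := by
    clear a
    induction k with
    | zero =>
      intro w y
      have : Matrix.single w y (1 : ℂ) = 1 := by
        ext i j
        rw [Subsingleton.elim i w, Subsingleton.elim j w, Subsingleton.elim y w]
        simp
      rw [this, map_one]
      exact one_mem _
    | succ k ih =>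
      intro w y
      rw [localObs_single_mul]
      refine mul_mem (map_mem_regionAlg (Set.mem_range_self 0) _) (regionAlg_mono ?_ (ih _ _ _))
      rintro _ ⟨j, rfl⟩
      exact ⟨j.succ, rfl⟩
  rw [map_eq_sum]
  exact sum_mem fun i _ => sum_mem fun j _ => Subalgebra.smul_mem _ (key i j) _

theorem IsLocalizedOn.mem_regionAlg {S : Set ι} {x : obsAlg ι d} (h : IsLocalizedOn S x) :
    x ∈ regionAlg (siteObs d) S := by
  obtain ⟨k, e, a, he, rfl⟩ := h
  exact regionAlg_mono he (localObs_mem_regionAlg e a)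

theorem mem_closure_regionAlg_siteObs (x : obsAlg ι d) :
    x ∈ closure (regionAlg (siteObs d) (Set.univ : Set ι) : Set (obsAlg ι d)) := by
  rw [closure_subtype]
  have h : ∀ (k : ℕ) (e : Fin k ↪ ι) (a : Matrix (Fin k → Fin d) (Fin k → Fin d) ℂ),
      localOp e a ∈ (regionAlg (siteObs d) Set.univ).map (obsAlg ι d).subtype.toAlgHom :=
    fun k e a => ⟨localObs e a, regionAlg_mono (Set.subset_univ _) (localObs_mem_regionAlg e a),
      rfl⟩
  suffices hle : (StarAlgebra.adjoin ℂ {A | ∃ (k : ℕ) (e : Fin k ↪ ι)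
      (a : Matrix (Fin k → Fin d) (Fin k → Fin d) ℂ), A = localOp e a}).toSubalgebra ≤
      (regionAlg (siteObs d) Set.univ).map (obsAlg ι d).subtype.toAlgHom by
    exact closure_mono (fun y hy => hle hy) x.2
  rw [StarAlgebra.adjoin_toSubalgebra]
  -- The *-algebra is the plain algebra generated by the local operators and their adjoints, and
  -- these adjoints are again local.
  refine Algebra.adjoin_le ?_
  rintro y (⟨k, e, a, rfl⟩ | ⟨k, e, a, hy⟩)
  · exact h k e a
  · rw [← star_star y, hy, ← map_star]
    exact h k e _

theorem sitePerm_mul (g h : Equiv.Perm ι) : sitePerm d (g * h) = sitePerm d g * sitePerm d h := by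
  ext ψ x
  rfl

theorem permAut_mul (g h : Equiv.Perm ι) (x : obsAlg ι d) :
    permAut d (g * h) x = permAut d g (permAut d h x) := by
  apply Subtype.ext
  change sitePerm d (g * h) * (x : L2 (Config ι d) →L[ℂ] L2 (Config ι d)) * sitePerm d (g * h)⁻¹ =
    sitePerm d g * (sitePerm d h * (x : L2 (Config ι d) →L[ℂ] L2 (Config ι d)) * sitePerm d h⁻¹) * sitePerm d g⁻¹
  rw [mul_inv_rev, sitePerm_mul, sitePerm_mul]
  simp only [mul_assoc]

theorem permAut_one (x : obsAlg ι d) : permAut d (1 : Equiv.Perm ι) x = x := by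
  apply Subtype.ext
  have h : sitePerm d (1 : Equiv.Perm ι) = 1 := pull_refl
  change sitePerm d 1 * (x : L2 (Config ι d) →L[ℂ] L2 (Config ι d)) * sitePerm d 1⁻¹ = _
  rw [inv_one, h, one_mul, mul_one]

/-- The site permutations that an automorphism commutes with. -/
def permStabilizer (u : obsAlg ι d ≃⋆ₐ[ℂ] obsAlg ι d) : Subgroup (Equiv.Perm ι) where
  carrier := {g | ∀ x, u (permAut d g x) = permAut d g (u x)}
  mul_mem' := fun {g h} hg hh x => by
    rw [permAut_mul, hg, hh, permAut_mul]
  one_mem' := fun x => by rw [permAut_one, permAut_one]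
  inv_mem' := fun {g} hg x => by
    apply EquivLike.injective (permAut d g)
    rw [← hg, ← permAut_mul, ← permAut_mul, mul_inv_cancel, permAut_one, permAut_one]

end LocalOperators

/-! ### The observables as a C*-algebra -/

section CStarCopy

/-- The algebra of observables with the structure of a C*-algebra. -/
def ObsCStar (ι : Type) (d : ℕ) : Type := obsAlg ι d

noncomputable instance (ι : Type) (d : ℕ) : CStarAlgebra (ObsCStar ι d) :=
  StarSubalgebra.cstarAlgebra (obsAlg ι d)
    (h_closed := StarSubalgebra.isClosed_topologicalClosure _)

/-- The identification of the algebra of observables with a C*-algebra. -/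
noncomputable def toCStar (ι : Type) (d : ℕ) : obsAlg ι d ≃⋆ₐ[ℂ] ObsCStar ι d where
  toFun x := x
  invFun x := x
  left_inv _ := rfl
  right_inv _ := rfl
  map_mul' _ _ := rfl
  map_add' _ _ := rfl
  map_star' _ := rfl
  map_smul' _ _ := rfl

theorem mem_closure_toCStar {ι : Type} {d : ℕ} {S : Set (obsAlg ι d)} {x : obsAlg ι d}
    (h : x ∈ closure S) : toCStar ι d x ∈ closure (toCStar ι d '' S) := by
  have hS : toCStar ι d '' S = S := Set.image_id S
  rw [hS]
  exact h

end CStarCopy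

/-! ### Regrouped sites and their translations -/

section Blocks

variable {k M : ℕ} (hk : k ∣ k * M)

theorem block_apply (n : ℤ) (i : Fin k) :
    block hk n i = ((k * n + (i : ℕ) : ℤ) : ZMod (k * M)) := rfl

/-- Lets the blocks be indexed by `ZMod M`, which treats the ring and the line (M = 0) alike. -/
theorem block_congr {n n' : ℤ} (h : (n : ZMod M) = n') : block hk n = block hk n' := by
  ext i
  rw [block_apply, block_apply, ZMod.intCast_eq_intCast_iff_dvd_sub]
  rw [ZMod.intCast_eq_intCast_iff_dvd_sub] at h
  have := mul_dvd_mul_left (k : ℤ) h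
  push_cast
  rw [add_sub_add_right_eq_sub, ← mul_sub]
  exact this

theorem eq_of_block_eq {n n' : ℤ} {i i' : Fin k} (h : block hk n i = block hk n' i') :
    (n : ZMod M) = n' := by
  have hk0 : (k : ℤ) ≠ 0 := by exact_mod_cast (Fin.pos i).ne'
  rw [block_apply, block_apply, ZMod.intCast_eq_intCast_iff_dvd_sub] at h
  push_cast at h
  have h2 : (k : ℤ) ∣ ((i' : ℕ) : ℤ) - ((i : ℕ) : ℤ) := by
    have h3 := ((Dvd.intro _ rfl).trans h).sub (Dvd.intro (n' - n) rfl : (k : ℤ) ∣ k * (n' - n))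
    have h4 : (k * n' + (i' : ℕ) - (k * n + (i : ℕ)) - k * (n' - n) : ℤ) = (i' : ℕ) - (i : ℕ) := by
      ring
    rwa [h4] at h3
  have h4 : (i : ℕ) ≡ (i' : ℕ) [MOD k] := Int.natCast_modEq_iff.1 (Int.modEq_iff_dvd.2 h2)
  have h5 : (i : ℕ) = i' := Nat.ModEq.eq_of_lt_of_lt h4 i.2 i'.2
  rw [ZMod.intCast_eq_intCast_iff_dvd_sub]
  refine Int.dvd_of_mul_dvd_mul_left hk0 ?_
  rwa [h5, add_sub_add_right_eq_sub, ← mul_sub] at h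

theorem exists_block_eq (hk0 : 0 < k) (y : ℤ) :
    ∃ n i, block hk n i = (y : ZMod (k * M)) ∧ y = k * n + (i : ℕ) := by
  have hk0' : (k : ℤ) ≠ 0 := by exact_mod_cast hk0.ne'
  have h1 := Int.emod_nonneg y hk0'
  have h2 := Int.emod_lt_of_pos y (by exact_mod_cast hk0 : (0 : ℤ) < k)
  have h3 : y = k * (y / k) + ((y % k).toNat : ℕ) := by
    rw [Int.toNat_of_nonneg h1]
    exact (Int.mul_ediv_add_emod y k).symm
  refine ⟨y / k, ⟨(y % k).toNat, by omega⟩, ?_, h3⟩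
  rw [block_apply]
  exact congrArg _ h3.symm

theorem disjoint_block {n n' : ℤ} (h : (n : ZMod M) ≠ n') :
    Disjoint (Set.range (block hk n)) (Set.range (block hk n')) := by
  rw [Set.disjoint_left]
  rintro _ ⟨i, rfl⟩ ⟨i', hi'⟩
  exact h (eq_of_block_eq hk hi').symm

/-- The matrix algebras of the regrouped sites, indexed by the regrouped line or ring. -/
noncomputable def blockFam (d : ℕ) (j : ZMod M) :
    Matrix (Fin k → Fin d) (Fin k → Fin d) ℂ →⋆ₐ[ℂ] obsAlg (ZMod (k * M)) d :=
  blockObs hk (j.cast : ℤ)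

variable {d : ℕ}

theorem blockFam_intCast (n : ℤ) : blockFam hk d (n : ZMod M) = blockObs hk n := by
  rw [blockFam, blockObs, blockObs, block_congr hk (ZMod.intCast_zmod_cast _)]

theorem exists_intCast_eq {M : ℕ} (j : ZMod M) : ∃ n : ℤ, (n : ZMod M) = j :=
  ⟨j.cast, ZMod.intCast_zmod_cast j⟩

theorem blockFam_commute (i j : ZMod M) (h : i ≠ j)
    (a b : Matrix (Fin k → Fin d) (Fin k → Fin d) ℂ) :
    Commute (blockFam hk d i a) (blockFam hk d j b) := by
  obtain ⟨n, rfl⟩ := exists_intCast_eq i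
  obtain ⟨n', rfl⟩ := exists_intCast_eq j
  rw [blockFam_intCast, blockFam_intCast]
  exact localObs_commute (disjoint_block hk h) a b

theorem siteObs_block_mem {G : Set (ZMod M)} {n : ℤ} (hn : (n : ZMod M) ∈ G) (i : Fin k)
    (a : Matrix (Fin 1 → Fin d) (Fin 1 → Fin d) ℂ) :
    siteObs d (block hk n i) a ∈ regionAlg (blockFam hk d) G := by
  obtain ⟨b, hb⟩ := exists_localObs_eq_siteObs (d := d) (block hk n) i a
  rw [← hb, ← blockObs, ← blockFam_intCast]
  exact map_mem_regionAlg hn b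

theorem mem_closure_regionAlg_blockFam (hk0 : 0 < k) (x : obsAlg (ZMod (k * M)) d) :
    x ∈ closure (regionAlg (blockFam hk d) Set.univ : Set (obsAlg (ZMod (k * M)) d)) := by
  refine closure_mono ?_ (mem_closure_regionAlg_siteObs x)
  refine regionAlg_le fun y _ a => ?_
  obtain ⟨n, i, hni, -⟩ := exists_block_eq hk hk0 (y.cast : ℤ)
  rw [ZMod.intCast_zmod_cast] at hni
  rw [← hni]
  exact siteObs_block_mem hk (Set.mem_univ _) i a

/-- Translation by `n` regrouped sites. -/
def blockShift (k M : ℕ) (n : ℤ) : Equiv.Perm (ZMod (k * M)) :=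
  Equiv.addRight (((k * n : ℤ)) : ZMod (k * M))

theorem blockShift_block (n n' : ℤ) (i : Fin k) :
    blockShift k M n (block hk n' i) = block hk (n + n') i := by
  simp only [blockShift, Equiv.coe_addRight, block_apply, ← Int.cast_add]
  congr 1
  ring

theorem permAut_blockShift (n n' : ℤ) (a : Matrix (Fin k → Fin d) (Fin k → Fin d) ℂ) :
    permAut d (blockShift k M n) (blockObs hk n' a) = blockObs hk (n + n') a := by
  have h : (block hk n').trans (blockShift k M n).toEmbedding = block hk (n + n') := by
    ext i
    exact blockShift_block hk n n' i
  exact (permAut_localObs _ _ _).trans (by rw [h])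

/-- Translation by `n` blocks is the `k n`-th power of translation by one site, and the stabilizer
is a group. -/
theorem IsQCA.blockShift_mem_permStabilizer {L : ℕ}
    {u : obsAlg (ZMod (k * M)) d ≃⋆ₐ[ℂ] obsAlg (ZMod (k * M)) d} (hu : IsQCA L u) (n : ℤ) :
    blockShift k M n ∈ permStabilizer u := by
  have h1 : Equiv.addRight (1 : ZMod (k * M)) ∈ permStabilizer u := hu.translation_invariant
  have := zpow_mem h1 (k * n)
  rwa [Equiv.zsmul_addRight, zsmul_one] at this

end Blocks

/-! ### The shift of the left halves -/

section HalfShift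

variable {r M : ℕ} (hk : 2 * r ∣ 2 * r * M)

/-- The left halves of the regrouped sites. -/
def IsLeft (x : ZMod (2 * r * M)) : Prop :=
  (ZMod.castHom (Dvd.intro M rfl) (ZMod (2 * r)) x).val < r

theorem isLeft_add (x : ZMod (2 * r * M)) (n : ℤ) :
    IsLeft (x + (((2 * r : ℕ) * n : ℤ) : ZMod (2 * r * M))) ↔ IsLeft x := by
  rw [IsLeft, map_add, map_intCast, Int.cast_mul, Int.cast_natCast, ZMod.natCast_self, zero_mul,
    add_zero, IsLeft]

theorem isLeft_block (n : ℤ) (i : Fin (2 * r)) :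
    IsLeft (block hk n i) ↔ (i : ℕ) < r := by
  rw [IsLeft, block_apply, map_intCast, Int.cast_add, Int.cast_mul, Int.cast_natCast,
    ZMod.natCast_self, zero_mul, zero_add, Int.cast_natCast, ZMod.val_natCast_of_lt i.2]

open Classical in
/-- The permutation of the sites moving the left half of every regrouped site to the right by one
regrouped site. -/
noncomputable def halfShift (r M : ℕ) : Equiv.Perm (ZMod (2 * r * M)) where
  toFun x := if IsLeft x then x + (((2 * r : ℕ) * (1 : ℤ) : ℤ) : ZMod (2 * r * M)) else x
  invFun x := if IsLeft x then x + (((2 * r : ℕ) * (-1 : ℤ) : ℤ) : ZMod (2 * r * M)) else x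
  left_inv x := by
    by_cases h : IsLeft x
    · simp only [h, if_true, isLeft_add, add_assoc, ← Int.cast_add]
      simp
    · simp [h]
  right_inv x := by
    by_cases h : IsLeft x
    · simp only [h, if_true, isLeft_add, add_assoc, ← Int.cast_add]
      simp
    · simp [h]

theorem halfShift_of_isLeft {x : ZMod (2 * r * M)} (h : IsLeft x) :
    halfShift r M x = blockShift (2 * r) M 1 x := if_pos h

theorem halfShift_of_not_isLeft {x : ZMod (2 * r * M)} (h : ¬ IsLeft x) :
    halfShift r M x = x := if_neg h

theorem isLeft_blockShift (n : ℤ) (x : ZMod (2 * r * M)) :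
    IsLeft (blockShift (2 * r) M n x) ↔ IsLeft x := isLeft_add x n

theorem halfShift_mul_blockShift (n : ℤ) :
    halfShift r M * blockShift (2 * r) M n = blockShift (2 * r) M n * halfShift r M := by
  ext x
  rw [Equiv.Perm.mul_apply, Equiv.Perm.mul_apply]
  by_cases h : IsLeft x
  · rw [halfShift_of_isLeft h, halfShift_of_isLeft ((isLeft_blockShift n x).2 h)]
    simp only [blockShift, Equiv.coe_addRight]
    ring
  · rw [halfShift_of_not_isLeft h, halfShift_of_not_isLeft (mt (isLeft_blockShift n x).1 h)]

theorem halfShift_block_of_lt (n : ℤ) {i : Fin (2 * r)} (hi : (i : ℕ) < r) :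
    halfShift r M (block hk n i) = block hk (1 + n) i := by
  rw [halfShift_of_isLeft ((isLeft_block hk n i).2 hi), blockShift_block]

theorem halfShift_block_of_le (n : ℤ) {i : Fin (2 * r)} (hi : r ≤ (i : ℕ)) :
    halfShift r M (block hk n i) = block hk n i :=
  halfShift_of_not_isLeft fun h => absurd ((isLeft_block hk n i).1 h) (not_lt.2 hi)

/-- The sites near a regrouped site are, up to the shift of the left halves, in that regrouped site
or in the preceding one. -/
theorem exists_halfShift_block_eq {L : ℕ} (hLr : L ≤ r) (n : ℤ) (i : Fin (2 * r))
    {y : ZMod (2 * r * M)} (hy : y ∈ nbhd L (block hk n i)) :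
    ∃ n' i', (n' = n ∨ n' = n - 1) ∧ halfShift r M (block hk n' i') = y := by
  obtain ⟨j, hj, rfl⟩ := hy
  have hi := i.2
  obtain ⟨hj1, hj2⟩ := abs_le.1 hj
  have hL : (L : ℤ) ≤ r := by exact_mod_cast hLr
  have key : ∀ (n' : ℤ) (i' : ℤ), 2 * r * n + (i : ℕ) + j = 2 * r * n' + i' →
      0 ≤ i' → i' < 2 * r → ∃ i'' : Fin (2 * r), ((i'' : ℕ) : ℤ) = i' ∧
        block hk n' i'' = block hk n i + (j : ZMod (2 * r * M)) := by
    intro n' i' h h0 h1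
    refine ⟨⟨i'.toNat, by omega⟩, Int.toNat_of_nonneg h0, ?_⟩
    rw [block_apply, block_apply, ← Int.cast_add]
    congr 1
    push_cast
    rw [Int.toNat_of_nonneg h0]
    exact h.symm
  -- Four positions of the target: right half of `n - 1`, left half of `n`, right half of `n`, left
  -- half of `n + 1`. Left halves come from one block earlier, so the sources are `n - 1`, `n - 1`,
  -- `n`, `n`. The bound `L ≤ r` excludes anything further away.
  rcases lt_or_ge ((i : ℕ) + j : ℤ) 0 with h | h
  · obtain ⟨i'', hi'', h'⟩ := key (n - 1) (i + j + 2 * r) (by ring) (by omega) (by omega)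
    exact ⟨n - 1, i'', Or.inr rfl, by rw [halfShift_block_of_le hk _ (by omega), h']⟩
  rcases lt_or_ge ((i : ℕ) + j : ℤ) r with h' | h'
  · obtain ⟨i'', hi'', h''⟩ := key n (i + j) (by ring) (by omega) (by omega)
    refine ⟨n - 1, i'', Or.inr rfl, ?_⟩
    rw [halfShift_block_of_lt hk _ (by omega), add_sub_cancel, h'']
  rcases lt_or_ge ((i : ℕ) + j : ℤ) (2 * r) with h'' | h''
  · obtain ⟨i'', hi'', h3⟩ := key n (i + j) (by ring) (by omega) (by omega)
    exact ⟨n, i'', Or.inl rfl, by rw [halfShift_block_of_le hk _ (by omega), h3]⟩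
  · obtain ⟨i'', hi'', h3⟩ := key (1 + n) (i + j - 2 * r) (by ring) (by omega) (by omega)
    exact ⟨n, i'', Or.inl rfl, by rw [halfShift_block_of_lt hk _ (by omega), h3]⟩

variable {d : ℕ}

theorem permAut_halfShift_comm (n : ℤ) (x : obsAlg (ZMod (2 * r * M)) d) :
    permAut d (halfShift r M) (permAut d (blockShift (2 * r) M n) x) =
      permAut d (blockShift (2 * r) M n) (permAut d (halfShift r M) x) :=
  (permAut_mul _ _ x).symm.trans ((congrArg (fun g => permAut d g x)
    (halfShift_mul_blockShift n)).trans (permAut_mul _ _ x))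

end HalfShift

/-! ### Combining the half shift with the automaton -/

section Main

variable {r M d : ℕ} (hk : 2 * r ∣ 2 * r * M)

/-- The half shift commutes with block translations, so its behaviour at block 0 spreads to all
blocks. -/
theorem halfShift_blockObs_of_eq {n : ℤ}
    {a : Matrix (Fin (2 * r) → Fin d) (Fin (2 * r) → Fin d) ℂ}
    (ha : permAut d (halfShift r M) (blockObs hk 0 a) = blockObs hk n a) (n' : ℤ) :
    permAut d (halfShift r M) (blockObs hk n' a) = blockObs hk (n' + n) a := by
  have h := permAut_blockShift (d := d) hk n' 0 a
  rw [add_zero] at h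
  exact (congrArg _ h.symm).trans ((permAut_halfShift_comm n' _).trans
    ((congrArg _ ha).trans (permAut_blockShift hk n' n a)))

theorem exists_halfShift_siteObs (i : Fin (2 * r))
    (a : Matrix (Fin 1 → Fin d) (Fin 1 → Fin d) ℂ) :
    ∃ b, blockObs hk 0 b = siteObs d (block hk 0 i) a ∧
      (permAut d (halfShift r M) (blockObs hk 0 b) = blockObs hk 1 b ∨
        permAut d (halfShift r M) (blockObs hk 0 b) = blockObs hk 0 b) := by
  obtain ⟨b, hb⟩ := exists_localObs_eq_siteObs (d := d) (block hk 0) i a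
  refine ⟨b, hb, ?_⟩
  have h := (congrArg (permAut d (halfShift r M)) hb).trans (permAut_siteObs _ _ _)
  rcases lt_or_ge (i : ℕ) r with hi | hi
  · left
    rw [halfShift_block_of_lt hk 0 hi, ← blockShift_block] at h
    refine h.trans ((permAut_siteObs _ _ _).symm.trans ((congrArg _ hb.symm).trans ?_))
    exact permAut_blockShift hk 1 0 b
  · right
    rw [halfShift_block_of_le hk 0 hi] at h
    exact h.trans hb.symm

theorem isPartialShift_halfShift (hd : 0 < d) (hM : (1 : ZMod M) ≠ 0) :
    IsPartialShift hk 1 (permAut d (halfShift r M)) := by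
  have := nontrivial_obsAlg (ι := ZMod (2 * r * M)) hd
  have h10 : ((1 : ℤ) : ZMod M) ≠ (0 : ℤ) := by simpa using hM
  obtain ⟨P, Q, hcomm, hbij, hP, hQ⟩ := exists_factorization_of_generators
    (β₀ := blockObs (d := d) hk 0) (β₁ := blockObs hk 1)
    (fun a b => localObs_commute (disjoint_block hk h10) a b) (permAut d (halfShift r M))
    (T := {x | ∃ j ∈ Set.range (block hk 0), ∃ a, siteObs d j a = x})
    (fun a => localObs_mem_regionAlg (block hk 0) a)
    (by rintro _ ⟨_, ⟨i, rfl⟩, a, rfl⟩; exact exists_halfShift_siteObs hk i a)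
  refine ⟨P, Q, hcomm, hbij, fun n a ha => halfShift_blockObs_of_eq hk (hP a ha) n,
    fun n a ha => ?_⟩
  have := halfShift_blockObs_of_eq hk (hQ a ha) n
  rwa [add_zero] at this

variable {L : ℕ} {u : obsAlg (ZMod (2 * r * M)) d ≃⋆ₐ[ℂ] obsAlg (ZMod (2 * r * M)) d}

/-- Causality is known for single sites only, so the inclusion is checked on one-site generators and
extended multiplicatively. -/
theorem IsQCA.halfShift_symm_comp_mem (hu : IsQCA L u) (hLr : L ≤ r) (n : ZMod M)
    (a : Matrix (Fin (2 * r) → Fin d) (Fin (2 * r) → Fin d) ℂ) :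
    u.trans (permAut d (halfShift r M)).symm (blockFam hk d n a) ∈
      regionAlg (blockFam hk d) {n, n - 1} := by
  obtain ⟨n, rfl⟩ := exists_intCast_eq n
  rw [blockFam_intCast]
  refine starAlgEquiv_mem_of_mem_regionAlg (u.trans (permAut d (halfShift r M)).symm)
    (fun x hx b => ?_) (localObs_mem_regionAlg (block hk n) a)
  obtain ⟨i, rfl⟩ := hx
  refine starAlgEquiv_mem_of_mem_regionAlg (permAut d (halfShift r M)).symm (fun y hy c => ?_)
    (hu.causal _ _ (isLocalizedOn_siteObs (block hk n i) b)).mem_regionAlg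
  obtain ⟨n', i', hn', rfl⟩ := exists_halfShift_block_eq hk hLr n i hy
  have h : (permAut d (halfShift r M)).symm (siteObs d (halfShift r M (block hk n' i')) c) =
      siteObs d (block hk n' i') c := by
    rw [StarAlgEquiv.symm_apply_eq]
    exact (permAut_siteObs _ _ _).symm
  rw [h]
  refine siteObs_block_mem hk ?_ i' c
  rcases hn' with rfl | rfl
  · exact Or.inl rfl
  · exact Or.inr (by simp)

-- Block translations commute with both `u` and the half shift, hence with the composite.
set_option maxHeartbeats 2000000 in
theorem IsQCA.exists_blockShift (hu : IsQCA L u) (n : ZMod M) :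
    ∃ τ : obsAlg (ZMod (2 * r * M)) d ≃⋆ₐ[ℂ] obsAlg (ZMod (2 * r * M)) d,
      (∀ i a, τ (blockFam hk d i a) = blockFam hk d (n + i) a) ∧
      ∀ x, u.trans (permAut d (halfShift r M)).symm (τ x) =
        τ (u.trans (permAut d (halfShift r M)).symm x) := by
  obtain ⟨n, rfl⟩ := exists_intCast_eq n
  refine ⟨permAut d (blockShift (2 * r) M n), ?_, ?_⟩
  · intro i a
    obtain ⟨i, rfl⟩ := exists_intCast_eq i
    rw [← Int.cast_add, blockFam_intCast, blockFam_intCast]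
    exact permAut_blockShift hk n i a
  · intro x
    rw [StarAlgEquiv.trans_apply, StarAlgEquiv.trans_apply, StarAlgEquiv.symm_apply_eq]
    refine (hu.blockShift_mem_permStabilizer n x).trans (Eq.trans ?_
      (permAut_halfShift_comm n _).symm)
    exact congrArg _ (StarAlgEquiv.apply_symm_apply _ _).symm

end Main

end QCA

/-! ### The decomposition -/

open QCA in
set_option maxHeartbeats 2000000 in
theorem mainTheorem11 (N d L r : ℕ) (hd : 0 < d)
    (u : QCA.obsAlg (ZMod N) d ≃⋆ₐ[ℂ] QCA.obsAlg (ZMod N) d) (hu : QCA.IsQCA L u)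
    (hr : 0 < r) (hLr : L ≤ r) (hk : 2 * r ∣ N) (hN : N = 0 ∨ 3 * (2 * r) ≤ N) :
    ∃ sl w sr v : QCA.obsAlg (ZMod N) d ≃⋆ₐ[ℂ] QCA.obsAlg (ZMod N) d,
      QCA.IsPartialShift hk 1 sl ∧ QCA.IsOnSiteUnitary hk w ∧
      QCA.IsPartialShift hk (-1) sr ∧ QCA.IsOnSiteUnitary hk v ∧
      ∀ A, u A = sl (w (sr (v A))) := by
  -- A copy is destructed because the goal itself depends on `hk`.
  have hk' := hk
  obtain ⟨M, rfl⟩ := hk'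
  have hM : M = 0 ∨ 3 ≤ M := by
    refine hN.imp (fun h => ?_) fun h => ?_
    · simpa [hr.ne'] using h
    · rw [mul_comm 3] at h
      exact Nat.le_of_mul_le_mul_left h (by omega)
  have := nontrivial_obsAlg (ι := ZMod (2 * r * M)) hd
  -- At least three blocks, or infinitely many: 1 and 2 do not vanish modulo `M`.
  have hne : ∀ n : ℕ, 0 < n → n < 3 → (n : ZMod M) ≠ 0 := fun n hn hn3 h => by
    rw [ZMod.natCast_eq_zero_iff] at h
    rcases hM with rfl | hM
    · exact hn.ne' (zero_dvd_iff.1 h)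
    · exact absurd (Nat.le_of_dvd hn h) (by omega)
  have h1 : (1 : ZMod M) ≠ 0 := by simpa using hne 1 one_pos (by norm_num)
  have h2 : (1 + 1 : ZMod M) ≠ 0 := by
    have := hne 2 two_pos (by norm_num)
    rwa [Nat.cast_ofNat, ← one_add_one_eq_two] at this
  have : Nonempty (Fin d) := ⟨⟨0, hd⟩⟩
  obtain ⟨W, hW, w, sr, hw, hsr, P, Q, hPQ, hbij, hP, hQ⟩ := exists_onSite_comp_shift_of_equiv
    (toCStar (ZMod (2 * r * M)) d) (blockFam_commute (d := d) hk)
    (fun x => mem_closure_toCStar (mem_closure_regionAlg_blockFam hk (by omega) x)) h1 h2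
    (t := u.trans (permAut d (halfShift r M)).symm) (hu.halfShift_symm_comp_mem hk hLr)
    (hu.exists_blockShift hk)
  -- The factor `v` is the identity, with unitary 1.
  refine ⟨permAut d (halfShift r M), w, sr, StarAlgEquiv.refl ℂ _, isPartialShift_halfShift hk hd h1,
    ⟨W, hW, fun n a => ?_⟩, ⟨P, Q, hPQ, hbij, fun n a ha => ?_, fun n a ha => ?_⟩,
    ⟨1, one_mem _, fun n a => ?_⟩, fun x => ?_⟩
  · have := hw n a
    rwa [blockFam_intCast] at this
  · have := hP n a ha
    rwa [blockFam_intCast, sub_eq_add_neg, ← Int.cast_one, ← Int.cast_neg, ← Int.cast_add,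
      blockFam_intCast] at this
  · have := hQ n a ha
    rwa [blockFam_intCast] at this
  · rw [star_one, one_mul, mul_one]
    rfl
  · have : (permAut d (halfShift r M)).symm (u x) = w (sr x) := hsr x
    exact (StarAlgEquiv.symm_apply_eq _).1 this
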